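/- Let $\mathcal B$ be a locally finitely presentable category (the category of set-valued models of a finite limit theory $\mathbb T$, whose syntactic category is $\mathcal B_{fp}^{op}$, where $\mathcal B_{fp}$ is the full subcategory of finitely presented objects). A *geometry* on $\mathcal B$ consists of - a *saturated class* $\mathcal V$: a class of maps between finitely presented objects of $\mathcal B$ which contains the isomorphisms between such objects, is closed under composition, under pushout along arbitrary maps of $\mathcal B_{fp}$ and under finite colimits in the category of arrows of $\mathcal B$, and is right-cancellative ($l\in\mathcal V$ and $fl\in\mathcal V$ imply $f\in\mathcal V$); - a Grothendieck topology $J$ on $\mathcal B_{fp}^{op}$ whose covers are generated by duals of maps in $\mathcal V$, i.e. every covering sieve contains a covering sieve generated by duals of maps in $\mathcal V$. For an object $B$, let $\mathcal V_B$ be the full subcategory of the coslice $B\downarrow\mathcal B$ on the *finitely presented etale arrows* under $B$, i.e. the arrows $n:B\to C$ that are the pushout of some $l:K\to K'$ in $\mathcal V$ along some $a:K\to B$. Let $J_B$ be the Grothendieck topology on $\mathcal V_B^{op}$ generated by the duals of the families $(m_i:n\to n_i)_{i\in I}$ in $\mathcal V_B$, with $n:B\to C$ and $n_i:B\to C_i$,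 for which there are $b:K\to C$ and a family $(l_i:K\to K_i)_{i\in I}$ in $\mathcal B_{fp}$ dual to a $J$-covering family such that each $m_i$ is the pushout of $l_i$ along $b$. Put $$\mathrm{Spec}(B)=\mathrm{Sh}(\mathcal V_B^{op},J_B),\qquad \iota_B:\mathrm{Spec}(B)\hookrightarrow\widehat{\mathcal V_B^{op}},$$ where $\widehat{\mathcal V_B^{op}}=[\mathcal V_B,\mathbf{Set}]$ and $\iota_B$ is the geometric morphism whose inverse image is the sheafification functor $\mathfrak a_{J_B}$. For $n\in\mathcal V_B$ write $y^*_n=\mathcal V_B(n,-)\in\widehat{\mathcal V_B^{op}}$. For $f:B_1\to B_2$, the inverse image part of $\mathrm{Spec}(f):\mathrm{Spec}(B_2)\to\mathrm{Spec}(B_1)$ is the left Kan extension, along $\mathfrak a_{J_{B_1}}y^*:\mathcal V_{B_1}^{op}\to\mathrm{Spec}(B_1)$, of the pushout functor $f_*:\mathcal V_{B_1}^{op}\to\mathcal V_{B_2}^{op}$ followed by $\mathfrak a_{J_{B_2}}y^*:\mathcal V_{B_2}^{op}\to\mathrm{Spec}(B_2)$. **Proposition.** Let $n:B\to C$ be a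 finitely presented etale arrow under $B$. Then the above left Kan extension for $f=n$ is the inverse image part of a geometric morphism $\mathrm{Spec}(n):\mathrm{Spec}(C)\to\mathrm{Spec}(B)$, and there is an equivalence $$\mathrm{Spec}(C)\simeq\mathrm{Spec}(B)/\mathfrak a_{J_B}(y^*_n)$$ which identifies $\mathrm{Spec}(n)$, up to isomorphism, with the canonical geometric morphism $\mathrm{Spec}(B)/\mathfrak a_{J_B}(y^*_n)\to\mathrm{Spec}(B)$ (with inverse image $A\mapsto (\mathfrak a_{J_B}(y^*_n)\times A\to \mathfrak a_{J_B}(y^*_n))$); in particular $\mathrm{Spec}(n)$ is an etale geometric morphism. Moreover the slices below are Grothendieck toposes and there is a $2$-pullback square in the bicategory of Grothendieck toposes $$\begin{array}{ccc}\mathrm{Spec}(B)/\mathfrak a_{J_B}(y^*_n)&\longrightarrow&\widehat{\mathcal V_B^{op}}/y^*_n\\ \downarrow&&\downarrow\\ \mathrm{Spec}(B)&\overset{\iota_B}{\longrightarrow}&\widehat{\mathcal V_B^{op}}\end{array}$$ whose vertical arrows are the canonical etale geometric morphisms and whose top arrow has as inverse image the functor $(P\to y^*_n)\mapsto(\mathfrak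 a_{J_B}P\to\mathfrak a_{J_B}(y^*_n))$ induced by $\mathfrak a_{J_B}$. Through the equivalence above, this exhibits $\mathrm{Spec}(n):\mathrm{Spec}(C)\to\mathrm{Spec}(B)$ as the $2$-pullback along $\iota_B$ of the canonical etale geometric morphism $\widehat{\mathcal V_B^{op}}/y^*_n\to\widehat{\mathcal V_B^{op}}$. -/

import Mathlib

open CategoryTheory CategoryTheory.Limits Opposite

universe w v₁ v₂ v₃ v₄ v u₁ u₂ u₃ u₄ u

noncomputable section

/-! ## Grothendieck toposes and geometric morphisms -/

/-- A Grothendieck topos (relative to the universe `w` of sets): a category equivalent to the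
category of sheaves of sets on a small site. -/
class IsGrothendieckTopos.{w', v', u'} (E : Type u') [Category.{v'} E] : Prop where
  exists_site : ∃ (C : Type w') (_ : SmallCategory.{w'} C) (J : GrothendieckTopology C),
    Nonempty (E ≌ Sheaf J (Type w'))

/-- A geometric morphism `E ⟶ F`: an adjunction `f^* ⊣ f_*` with `f_* : E ⥤ F` and `f^*` preserving
finite limits. -/
structure GeometricMorphism (E : Type u₁) [Category.{v₁} E] (F : Type u₂) [Category.{v₂} F] where
  inverse : F ⥤ E
  direct : E ⥤ F
  adj : inverse ⊣ direct
  preservesFiniteLimits : PreservesFiniteLimits inverse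

namespace GeometricMorphism

section

variable {E : Type u₁} [Category.{v₁} E] {F : Type u₂} [Category.{v₂} F]
  {G : Type u₃} [Category.{v₃} G] {H : Type u₄} [Category.{v₄} H]

/-- The `2`-cells `f ⟹ g` are the natural transformations `f^* ⟹ g^*`. -/
instance : Category (GeometricMorphism E F) :=
  inferInstanceAs (Category (InducedCategory (F ⥤ E) GeometricMorphism.inverse))

/-- The `2`-cell given by a natural transformation of inverse images. -/
def homMk {f g : GeometricMorphism E F} (α : f.inverse ⟶ g.inverse) : f ⟶ g :=
  InducedCategory.homMk α

/-- The natural transformation of inverse images underlying a `2`-cell. -/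
def app {f g : GeometricMorphism E F} (α : f ⟶ g) : f.inverse ⟶ g.inverse :=
  InducedCategory.Hom.hom α

@[ext]
theorem hom_ext {f g : GeometricMorphism E F} {α β : f ⟶ g} (h : app α = app β) : α = β :=
  InducedCategory.hom_ext h

@[simp]
theorem app_homMk {f g : GeometricMorphism E F} (α : f.inverse ⟶ g.inverse) :
    app (homMk α) = α := rfl

@[simp]
theorem app_id (f : GeometricMorphism E F) : app (𝟙 f) = 𝟙 f.inverse := rfl

@[simp]
theorem app_comp {f g h : GeometricMorphism E F} (α : f ⟶ g) (β : g ⟶ h) :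
    app (α ≫ β) = app α ≫ app β := rfl

/-- The invertible `2`-cell given by a natural isomorphism of inverse images. -/
def isoMk {f g : GeometricMorphism E F} (α : f.inverse ≅ g.inverse) : f ≅ g :=
  InducedCategory.isoMk α

/-- The composite of `f : E ⟶ F` and `g : F ⟶ G`. -/
def comp (f : GeometricMorphism E F) (g : GeometricMorphism F G) : GeometricMorphism E G where
  inverse := g.inverse ⋙ f.inverse
  direct := f.direct ⋙ g.direct
  adj := g.adj.comp f.adj
  preservesFiniteLimits :=
    haveI := f.preservesFiniteLimits
    haveI := g.preservesFiniteLimits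
    comp_preservesFiniteLimits _ _

/-- Composition with a fixed geometric morphism `g : F ⟶ G`, as a functor
`Geom[E, F] ⥤ Geom[E, G]`. -/
def postcomp (E : Type u₁) [Category.{v₁} E] (g : GeometricMorphism F G) :
    GeometricMorphism E F ⥤ GeometricMorphism E G where
  obj f := f.comp g
  map α := homMk (Functor.whiskerLeft g.inverse (app α))
  map_id _ := by ext : 1; exact Functor.whiskerLeft_id' _
  map_comp _ _ := by ext : 1; exact Functor.whiskerLeft_comp _ _ _

/-- Composition with a fixed geometric morphism `f : E ⟶ F`, as a functor
`Geom[F, G] ⥤ Geom[E, G]`. -/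
def precomp (f : GeometricMorphism E F) (G : Type u₃) [Category.{v₃} G] :
    GeometricMorphism F G ⥤ GeometricMorphism E G where
  obj g := f.comp g
  map α := homMk (Functor.whiskerRight (app α) f.inverse)
  map_id _ := by ext : 1; exact Functor.whiskerRight_id' _
  map_comp _ _ := by ext : 1; exact Functor.whiskerRight_comp _ _ _

/-- The associativity isomorphism of the composition of geometric morphisms. -/
def assoc (f : GeometricMorphism E F) (g : GeometricMorphism F G) (h : GeometricMorphism G H) :
    (f.comp g).comp h ≅ f.comp (g.comp h) :=
  isoMk (Functor.associator h.inverse g.inverse f.inverse).symm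

/-- An equivalence of categories, seen as a geometric morphism. -/
def ofEquivalence (e : E ≌ F) : GeometricMorphism E F where
  inverse := e.inverse
  direct := e.functor
  adj := e.symm.toAdjunction
  preservesFiniteLimits := inferInstance

/-- The canonical geometric morphism `E / X ⟶ E`. Its inverse image sends `A` to the projection
`X × A ⟶ X`. -/
def etale [HasBinaryProducts E] (X : E) [(Over.star X).IsLeftAdjoint] :
    GeometricMorphism (Over X) E where
  inverse := Over.star X
  direct := (Over.star X).rightAdjoint
  adj := Adjunction.ofIsLeftAdjoint _
  preservesFiniteLimits :=
    haveI := (Over.forgetAdjStar X).rightAdjoint_preservesLimits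
    inferInstance

/-- A geometric morphism `f : E ⟶ F` is etale if it is equivalent, over `F`, to the canonical
geometric morphism `F / X ⟶ F` for some object `X` of `F`. -/
def IsEtale [HasBinaryProducts F] [∀ X : F, (Over.star X).IsLeftAdjoint]
    (f : GeometricMorphism E F) : Prop :=
  ∃ (X : F) (e : E ≌ Over X), Nonempty (f ≅ (ofEquivalence e).comp (etale X))

/-- If `F` preserves finite limits, then so does the functor it induces on slices. -/
theorem preservesFiniteLimits_post [HasFiniteLimits F] (L : F ⥤ E) [PreservesFiniteLimits L]
    (X : F) : PreservesFiniteLimits (Over.post (X := X) L) := by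
  have : PreservesLimit (Functor.empty.{0} (Over X)) (Over.post (X := X) L) :=
    preservesLimit_of_preserves_limit_cone (Over.mkIdTerminal (X := X)) <| by
      refine (IsLimit.equivOfNatIsoOfIso (Functor.emptyExt _ _) _ _ ?_).toFun
        (Over.mkIdTerminal (X := L.obj X))
      exact Cone.ext (Over.isoMk (Iso.refl _) ((Category.id_comp _).trans (L.map_id X))) (by simp)
  have := preservesLimitsOfShape_pempty_of_preservesTerminal (Over.post (X := X) L)
  have : PreservesLimitsOfShape WalkingCospan (Over.post (X := X) L) := by
    have : PreservesLimitsOfShape WalkingCospan (Over.post (X := X) L ⋙ Over.forget _) :=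
      inferInstanceAs (PreservesLimitsOfShape WalkingCospan (Over.forget X ⋙ L))
    exact preservesLimitsOfShape_of_reflects_of_preserves _ (Over.forget (L.obj X))
  exact preservesFiniteLimits_of_preservesTerminal_and_pullbacks _

/-- The geometric morphism `E / f^* Y ⟶ F / Y` induced by a geometric morphism `f : E ⟶ F` and an
object `Y` of `F`. Its inverse image sends `A ⟶ Y` to `f^* A ⟶ f^* Y`. -/
def slice [HasFiniteLimits F] (f : GeometricMorphism E F) (Y : F) :
    GeometricMorphism (Over (f.inverse.obj Y)) (Over Y) where
  inverse := Over.post f.inverse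
  direct := Over.post f.direct ⋙ Over.pullback (f.adj.unit.app Y)
  adj := Over.postAdjunctionLeft f.adj
  preservesFiniteLimits :=
    haveI := f.preservesFiniteLimits
    preservesFiniteLimits_post _ _

end

section

variable {P : Type u₁} [Category.{v₁} P] {A : Type u₂} [Category.{v₂} A]
  {B : Type u₃} [Category.{v₃} B] {D : Type u₄} [Category.{v₄} D]

/-- The comparison functor from `Geom[E, P]` to the pseudopullback of the categories `Geom[E, A]`
and `Geom[E, B]` over `Geom[E, D]`, for a square that commutes up to an invertible `2`-cell. -/
def comparison {p : GeometricMorphism P A} {q : GeometricMorphism P B}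
    {f : GeometricMorphism A D} {g : GeometricMorphism B D} (α : p.comp f ≅ q.comp g)
    (E : Type u) [Category.{v} E] :
    GeometricMorphism E P ⥤ CategoricalPullback (postcomp E f) (postcomp E g) where
  obj x :=
    { fst := x.comp p
      snd := x.comp q
      iso := assoc x p f ≪≫ (precomp x D).mapIso α ≪≫ (assoc x q g).symm }
  map {x y} β :=
    { fst := (postcomp E p).map β
      snd := (postcomp E q).map β
      w := hom_ext <| NatTrans.ext <| funext fun d => by
        have h := (app β).naturality ((app α.hom).app d)
        change (app β).app _ ≫ 𝟙 _ ≫ y.inverse.map ((app α.hom).app d) ≫ 𝟙 _ =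
          (𝟙 _ ≫ x.inverse.map ((app α.hom).app d) ≫ 𝟙 _) ≫ (app β).app _
        simp [h] }
  map_id x := by
    apply CategoricalPullback.Hom.ext
    · exact (postcomp E p).map_id x
    · exact (postcomp E q).map_id x
  map_comp β γ := by
    apply CategoricalPullback.Hom.ext
    · exact (postcomp E p).map_comp β γ
    · exact (postcomp E q).map_comp β γ

/-- The square
```
P --p--> A
|        |
q        f
v        v
B --g--> D
```
of geometric morphisms, which commutes up to the invertible `2`-cell `α`, is a `2`-pullback in the
bicategory of Grothendieck toposes. -/
def IsTwoPullback.{w', v', u', a₁, a₂, a₃, a₄, b₁, b₂, b₃, b₄}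
    {P : Type b₁} [Category.{a₁} P] {A : Type b₂} [Category.{a₂} A]
    {B : Type b₃} [Category.{a₃} B] {D : Type b₄} [Category.{a₄} D]
    {p : GeometricMorphism P A} {q : GeometricMorphism P B}
    {f : GeometricMorphism A D} {g : GeometricMorphism B D} (α : p.comp f ≅ q.comp g) : Prop :=
  ∀ (E : Type u') [Category.{v'} E] [IsGrothendieckTopos.{w'} E], (comparison α E).IsEquivalence

end

end GeometricMorphism

/-! ### Sheaves on an essentially small site -/

section

/-- In a cartesian closed category with finite limits, `A ↦ (X × A ⟶ X)` has a right adjoint. -/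
theorem star_isLeftAdjoint {E : Type u₁} [Category.{v₁} E] [CartesianMonoidalCategory E]
    [MonoidalClosed E] [HasFiniteLimits E] (X : E) : (Over.star X).IsLeftAdjoint := by
  let : BraidedCategory E := .ofCartesianMonoidalCategory
  let := ChosenPullbacksAlong.ofHasPullbacksAlong (curryRightUnitorHom X)
  have : (toOver X).IsLeftAdjoint := ⟨_, ⟨Over.toOverSectionsAdj X⟩⟩
  exact Functor.isLeftAdjoint_of_iso
    ((Over.forgetAdjStar X).rightAdjointUniq (forgetAdjToOver X)).symm

variable {C : Type u} [Category.{w} C] [EssentiallySmall.{w} C]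

theorem presheaf_star_isLeftAdjoint (X : Cᵒᵖ ⥤ Type w) : (Over.star X).IsLeftAdjoint :=
  letI : MonoidalClosed (Cᵒᵖ ⥤ Type w) := cartesianClosedOfEquiv (Functor.asEquivalence
    ((Functor.whiskeringLeft _ _ (Type w)).obj (equivSmallModel.{w} Cᵒᵖ).functor))
  star_isLeftAdjoint X

theorem presheaf_isGrothendieckTopos : IsGrothendieckTopos.{w} (Cᵒᵖ ⥤ Type w) where
  exists_site :=
    ⟨_, _, _, ⟨(equivSmallModel.{w} C).op.congrLeft.trans (sheafBotEquivalence _).symm⟩⟩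

variable (J : GrothendieckTopology C)

theorem hasSheafify_of_essentiallySmall : HasSheafify J (Type w) :=
  hasSheafifyEssentiallySmallSite.{w} J (Type w)

attribute [local instance] hasSheafify_of_essentiallySmall

theorem sheaf_star_isLeftAdjoint (X : Sheaf J (Type w)) : (Over.star X).IsLeftAdjoint :=
  letI : MonoidalClosed (Cᵒᵖ ⥤ Type w) := cartesianClosedOfEquiv (Functor.asEquivalence
    ((Functor.whiskeringLeft _ _ (Type w)).obj (equivSmallModel.{w} Cᵒᵖ).functor))
  @star_isLeftAdjoint _ _ _ (instMonoidalClosedSheafOfHasSheafifyOfFunctorOpposite J (Type w)) _ X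

/-- Sheaves on an essentially small site are sheaves on an equivalent small site. -/
def sheafEquivSmall :
    Sheaf J (Type w) ≌ Sheaf ((equivSmallModel.{w} C).inverse.inducedTopology J) (Type w) :=
  (equivSmallModel.{w} C).sheafCongr J _ (Type w)

theorem sheaf_isGrothendieckTopos : IsGrothendieckTopos.{w} (Sheaf J (Type w)) where
  exists_site := ⟨_, _, _, ⟨sheafEquivSmall J⟩⟩

theorem sheaf_locallySmall : LocallySmall.{w} (Sheaf J (Type w)) :=
  (locallySmall_congr (sheafEquivSmall J)).2 inferInstance

theorem sheaf_hasColimits : HasColimitsOfSize.{w, w} (Sheaf J (Type w)) :=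
  have : HasColimitsOfSize.{w, w}
      (Sheaf ((equivSmallModel.{w} C).inverse.inducedTopology J) (Type w)) :=
    hasColimits_of_reflective (sheafToPresheaf _ _)
  Adjunction.has_colimits_of_equivalence (sheafEquivSmall J).functor

/-- The inclusion `Sh(C, J) ⟶ PSh(C)` as a geometric morphism: the inverse image is
sheafification. -/
def sheafInclusion : GeometricMorphism (Sheaf J (Type w)) (Cᵒᵖ ⥤ Type w) where
  inverse := presheafToSheaf J (Type w)
  direct := sheafToPresheaf J (Type w)
  adj := sheafificationAdjunction J (Type w)
  preservesFiniteLimits := inferInstance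

end

/-! ## Geometries -/

section

variable (ℬ : Type u) [Category.{w} ℬ]

/-- The full subcategory of finitely presented objects. -/
abbrev FinPres : Type u := (ObjectProperty.isFinitelyPresentable.{w} ℬ).FullSubcategory

/-- A saturated class of maps of finite presentation in `ℬ`. -/
structure SaturatedClass where
  /-- the underlying class of maps -/
  maps : MorphismProperty ℬ
  source_mem {K K' : ℬ} (l : K ⟶ K') : maps l → IsFinitelyPresentable.{w} K
  target_mem {K K' : ℬ} (l : K ⟶ K') : maps l → IsFinitelyPresentable.{w} K'
  comp_mem {K K' K'' : ℬ} (l : K ⟶ K') (l' : K' ⟶ K'') : maps l → maps l' → maps (l ≫ l')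
  iso_mem {K K' : ℬ} (l : K ⟶ K') : IsFinitelyPresentable.{w} K → IsFinitelyPresentable.{w} K' →
    IsIso l → maps l
  /-- right cancellation -/
  cancel {K K' K'' : ℬ} (l : K ⟶ K') (f : K' ⟶ K'') : maps l → maps (l ≫ f) → maps f
  /-- closure under pushouts along maps of finite presentation -/
  pushout_mem {K K' L L' : ℬ} {l : K ⟶ K'} {k : K ⟶ L} {k' : K' ⟶ L'} {l' : L ⟶ L'} :
    IsPushout l k k' l' → IsFinitelyPresentable.{w} L → maps l → maps l'
  /-- closure under finite colimits in the category of arrows of `ℬ` -/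
  finiteColimits_mem (I : Type) [SmallCategory I] [FinCategory I] :
    maps.IsStableUnderColimitsOfShape I

/-- A geometry on `ℬ` (the category of set-valued models of a finite limit theory `𝕋`, the syntactic
category of `𝕋` being the opposite of the category of finitely presented objects of `ℬ`):
a saturated class `𝒱` and a Grothendieck topology `J` on the syntactic category whose covers are
generated by duals of maps in `𝒱`. -/
structure Geometry where
  𝒱 : SaturatedClass ℬ
  J : GrothendieckTopology (FinPres ℬ)ᵒᵖ
  generated (K : (FinPres ℬ)ᵒᵖ) (S : Sieve K) : S ∈ J K →
    ∃ R : Presieve K, (∀ ⦃L : (FinPres ℬ)ᵒᵖ⦄ (l : L ⟶ K), R l → 𝒱.maps l.unop.hom) ∧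
      Sieve.generate R ≤ S ∧ Sieve.generate R ∈ J K

end

namespace Geometry

variable {ℬ : Type u} [Category.{w} ℬ] (𝒢 : Geometry ℬ)

/-- An arrow `n : B ⟶ C` under `B` is a finitely presented etale arrow if it is a pushout
```
K --l--> K'
|        |
a        c
v        v
B --n--> C
```
of some map `l` in `𝒱`. -/
def IsFPEtale (B : ℬ) : ObjectProperty (Under B) := fun n =>
  ∃ (K K' : ℬ) (l : K ⟶ K') (a : K ⟶ B) (c : K' ⟶ n.right),
    𝒢.𝒱.maps l ∧ IsPushout l a c n.hom

/-- The etale generator `𝒱_B`: the full subcategory of `Under B` on the finitely presented etale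
arrows under `B`. -/
abbrev EtaleGenerator (B : ℬ) : Type (max u w) := (𝒢.IsFPEtale B).FullSubcategory

/-- The spectral site of `B` has underlying category `𝒱_B^op`. -/
abbrev Site (B : ℬ) : Type (max u w) := (𝒢.EtaleGenerator B)ᵒᵖ

/-- The families generating the topology `J_B` on `𝒱_B^op`: the duals of the families
`(m i : n ⟶ n' i)` in `𝒱_B`, with `n : B ⟶ C` and `n' i : B ⟶ C' i`, such that there are
`b : K ⟶ C` and a family `(l i : K ⟶ K' i)` dual to a covering family for `J`, each `m i` being the
pushout of `l i` along `b`. -/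
def coverings (B : ℬ) : Precoverage (𝒢.Site B) where
  coverings n := {R | ∃ (I : Type (max u w)) (n' : I → 𝒢.EtaleGenerator B)
    (m : ∀ i, n.unop ⟶ n' i) (K : FinPres ℬ) (K' : I → FinPres ℬ) (l : ∀ i, K ⟶ K' i)
    (b : K.obj ⟶ n.unop.obj.right) (b' : ∀ i, (K' i).obj ⟶ (n' i).obj.right),
    Sieve.generate (Presieve.ofArrows (fun i => op (K' i)) (fun i => (l i).op)) ∈ 𝒢.J (op K) ∧
    (∀ i, IsPushout (l i).hom b (b' i) (m i).hom.right) ∧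
    R = Presieve.ofArrows (fun i => op (n' i)) (fun i => (m i).op)}

/-- The Grothendieck topology `J_B` on `𝒱_B^op`. -/
def topology (B : ℬ) : GrothendieckTopology (𝒢.Site B) := (𝒢.coverings B).toGrothendieck

/-- The spectrum `Spec(B) = Sh(𝒱_B^op, J_B)`. -/
abbrev Spec (B : ℬ) : Type (max u (w + 1)) := Sheaf (𝒢.topology B) (Type w)

/-- The presheaf topos on `𝒱_B^op`. -/
abbrev PSh (B : ℬ) : Type (max u (w + 1)) := (𝒢.Site B)ᵒᵖ ⥤ Type w

variable [IsLocallyFinitelyPresentable.{w} ℬ]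

instance essentiallySmall_etaleGenerator (B : ℬ) : EssentiallySmall.{w} (𝒢.EtaleGenerator B) := by
  have : Fact (Cardinal.aleph0.{w}).IsRegular := ⟨Cardinal.isRegular_aleph0⟩
  have : ObjectProperty.EssentiallySmall.{w} (ObjectProperty.isFinitelyPresentable.{w} ℬ) :=
    inferInstanceAs (ObjectProperty.EssentiallySmall.{w}
      (isCardinalPresentable ℬ Cardinal.aleph0.{w}))
  obtain ⟨Q, _, hQ⟩ := ObjectProperty.EssentiallySmall.exists_small_le'.{w}
    (ObjectProperty.isFinitelyPresentable.{w} ℬ)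
  let φ : (Σ (K K' : Subtype Q), (K.1 ⟶ K'.1) × (K.1 ⟶ B)) → Under B :=
    fun x => Under.mk (pushout.inr x.2.2.1 x.2.2.2)
  have : ObjectProperty.EssentiallySmall.{w} (𝒢.IsFPEtale B) := by
    refine ⟨⟨ObjectProperty.ofObj φ, inferInstance, ?_⟩⟩
    rintro n ⟨K, K', l, a, c, hl, h⟩
    obtain ⟨K₀, hK₀, ⟨e⟩⟩ := hQ _ (𝒢.𝒱.source_mem l hl)
    obtain ⟨K₀', hK₀', ⟨e'⟩⟩ := hQ _ (𝒢.𝒱.target_mem l hl)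
    have h' : IsPushout (e.inv ≫ l ≫ e'.hom) (e.inv ≫ a) (e'.inv ≫ c) n.hom :=
      IsPushout.of_iso h e e' (Iso.refl _) (Iso.refl _) (by simp) (by simp) (by simp) (by simp)
    refine ⟨_, ⟨⟨⟨K₀, hK₀⟩, ⟨K₀', hK₀'⟩, e.inv ≫ l ≫ e'.hom, e.inv ≫ a⟩⟩, ⟨?_⟩⟩
    exact Under.isoMk h'.isoPushout (by simp [φ])
  infer_instance

instance (B : ℬ) : HasSheafify (𝒢.topology B) (Type w) := hasSheafify_of_essentiallySmall _

instance (B : ℬ) : LocallySmall.{w} (𝒢.Spec B) := sheaf_locallySmall _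

instance (B : ℬ) : HasColimitsOfSize.{w, w} (𝒢.Spec B) := sheaf_hasColimits _

instance (B : ℬ) : IsGrothendieckTopos.{w} (𝒢.Spec B) := sheaf_isGrothendieckTopos _

instance (B : ℬ) : IsGrothendieckTopos.{w} (𝒢.PSh B) := presheaf_isGrothendieckTopos

instance (B : ℬ) (X : 𝒢.Spec B) : (Over.star X).IsLeftAdjoint := sheaf_star_isLeftAdjoint _ X

instance (B : ℬ) (X : 𝒢.PSh B) : (Over.star X).IsLeftAdjoint := presheaf_star_isLeftAdjoint X

/-- The inclusion `ι_B : Spec(B) ⟶ PSh(𝒱_B^op)`; its inverse image is the sheafification functor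
`𝔞_{J_B}`. -/
def ι (B : ℬ) : GeometricMorphism (𝒢.Spec B) (𝒢.PSh B) := sheafInclusion (𝒢.topology B)

/-- The functor `𝒱_B^op ⥤ Spec(B)`, the Yoneda embedding followed by sheafification. -/
def generic (B : ℬ) : 𝒢.Site B ⥤ 𝒢.Spec B := yoneda ⋙ (𝒢.ι B).inverse

/-- The pushout functor `f_* : 𝒱_{B₁} ⥤ 𝒱_{B₂}` along `f : B₁ ⟶ B₂`. -/
def push {B₁ B₂ : ℬ} (f : B₁ ⟶ B₂) : 𝒢.EtaleGenerator B₁ ⥤ 𝒢.EtaleGenerator B₂ :=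
  ObjectProperty.lift _ ((𝒢.IsFPEtale B₁).ι ⋙ Under.pushout f) (by
    rintro ⟨n, K, K', l, a, c, hl, h⟩
    exact ⟨K, K', l, a ≫ f, c ≫ pushout.inl n.hom f, hl,
      h.paste_vert (IsPushout.of_hasPushout n.hom f)⟩)

instance {B₁ B₂ : ℬ} (F : 𝒢.Site B₁ ⥤ 𝒢.Spec B₂) :
    (𝒢.generic B₁).HasLeftKanExtension F := by
  have (Y : 𝒢.Spec B₁) : HasColimitsOfShape (CostructuredArrow (𝒢.generic B₁) Y) (𝒢.Spec B₂) :=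
    hasColimitsOfShape_of_essentiallySmall.{w} _ _
  have : (𝒢.generic B₁).HasPointwiseLeftKanExtension F := fun Y => inferInstance
  infer_instance

/-- The functor `Spec(B₁) ⥤ Spec(B₂)` which is the inverse image part of
`Spec(f) : Spec(B₂) ⟶ Spec(B₁)`, for `f : B₁ ⟶ B₂`: the left Kan extension along
`𝒱_{B₁}^op ⥤ Spec(B₁)` of `f_*` followed by `𝒱_{B₂}^op ⥤ Spec(B₂)`. -/
def specInverse {B₁ B₂ : ℬ} (f : B₁ ⟶ B₂) : 𝒢.Spec B₁ ⥤ 𝒢.Spec B₂ :=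
  (𝒢.generic B₁).leftKanExtension ((𝒢.push f).op ⋙ 𝒢.generic B₂)

/-- `g` is the geometric morphism `Spec(f) : Spec(B₂) ⟶ Spec(B₁)` (it is determined up to a
canonical isomorphism by its inverse image part). -/
def IsSpecMap {B₁ B₂ : ℬ} (f : B₁ ⟶ B₂) (g : GeometricMorphism (𝒢.Spec B₂) (𝒢.Spec B₁)) : Prop :=
  Nonempty (g.inverse ≅ 𝒢.specInverse f)

/-- The presheaf represented by an object `n` of `𝒱_B^op`. -/
def repr {B : ℬ} (n : 𝒢.EtaleGenerator B) : 𝒢.PSh B := yoneda.obj (op n)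

/-- The sheaf `𝔞_{J_B}` of the presheaf represented by `n`. -/
def sheafRepr {B : ℬ} (n : 𝒢.EtaleGenerator B) : 𝒢.Spec B := (𝒢.ι B).inverse.obj (𝒢.repr n)

end Geometry

end

/-! Two independent facts carry the proof.

The spectral site of `C` is the slice over `n` of the spectral site of `B`. Composition with `n`
turns etale arrows under `C` into arrows out of `n` in `𝒱_B`; this is an equivalence because etale
arrows compose (`Etale.comp`) and cancel (`Etale.of_comp`). Both follow by writing `B` as a filtered
colimit of finitely presented objects and descending to a stage where the axioms on `𝒱` apply. The
topologies correspond as well (`coverPreserving_siteOver`, `functorPullback_mem`). Presheaves on the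
slice site are presheaves over `y*_n`, and a map of these is locally bijective for `J_C` exactly
when it is so for `J_B`. So `Spec(C)` and `Spec(B)/𝔞(y*_n)` are localizations of one category at the
same maps (`overSheafEquivalence`). On representables, product with `y*_n` becomes the pushout
functor, since pushout is left adjoint to composition with `n`. The inverse image of the slice
morphism is a left adjoint, hence the Kan extension of its restriction to `generic`; it is therefore
the functor defining `Spec(n)`, whose left exactness comes for free (`isSpecMap_etaleSpec`).

A slice topos `E/X` classifies pairs of a morphism `g : T ⟶ E` and a global section of `g^* X`. Thus
`E/f^*Y` and the `2`-pullback of `F/Y ⟶ F` along `f` classify the same data. Uniqueness rests on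
`isPullback_overUnit`, which rebuilds each object of `F/Y` from objects `Y^* A` and the diagonal;
existence, in `exists_lift_of_section`, rests on the equivalence of `T` with `(T/g^*Y)/s` for a
section `s`. -/

noncomputable section

/-! ### Left exact functors out of a slice category. -/

namespace GeometricMorphism

section

variable {F : Type u₁} [Category.{v₁} F]

theorem star_obj_hom [HasBinaryProducts F] (Y A : F) :
    ((Over.star Y).obj A).hom = (prod.fst : Y ⨯ A ⟶ Y) :=
  prod.lift_fst (prod.fst : Y ⨯ A ⟶ Y) (𝟙 _)

/-- The second projection of the underlying object `Y ⨯ A` of `Y^* A`. -/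
def starSnd [HasBinaryProducts F] (Y A : F) : ((Over.star Y).obj A).left ⟶ A :=
  (prod.snd : Y ⨯ A ⟶ A)

theorem star_hom_ext [HasBinaryProducts F] {Y A Z : F} {f g : Z ⟶ ((Over.star Y).obj A).left}
    (h : f ≫ ((Over.star Y).obj A).hom = g ≫ ((Over.star Y).obj A).hom)
    (h' : f ≫ starSnd Y A = g ≫ starSnd Y A) : f = g := by
  rw [star_obj_hom] at h
  exact prod.hom_ext h h'

/-- A morphism to `Y^* A` is a morphism to `A`. -/
def homStar [HasBinaryProducts F] {Y A : F} {Z : Over Y} (f : Z.left ⟶ A) :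
    Z ⟶ (Over.star Y).obj A :=
  Over.homMk (prod.lift Z.hom f) ((_ ≫= star_obj_hom Y A).trans (prod.lift_fst _ _))

theorem homStar_left_snd [HasBinaryProducts F] {Y A : F} {Z : Over Y} (f : Z.left ⟶ A) :
    (homStar f).left ≫ starSnd Y A = f :=
  prod.lift_snd _ _

theorem star_map_left_snd [HasBinaryProducts F] (Y : F) {A B : F} (f : A ⟶ B) :
    ((Over.star Y).map f).left ≫ starSnd Y B = starSnd Y A ≫ f :=
  prod.map_snd _ _

theorem star_over_hom_ext [HasBinaryProducts F] {Y A : F} {Z : Over Y}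
    {f g : Z ⟶ (Over.star Y).obj A} (h : f.left ≫ starSnd Y A = g.left ≫ starSnd Y A) :
    f = g := by
  ext : 1
  exact star_hom_ext (by rw [Over.w, Over.w]) h

/-- The diagonal of `Y`, as a morphism `1 ⟶ Y^* Y` of `F / Y`. -/
def overDiag [HasBinaryProducts F] (Y : F) : Over.mk (𝟙 Y) ⟶ (Over.star Y).obj Y :=
  homStar (𝟙 Y)

theorem overDiag_left_snd [HasBinaryProducts F] (Y : F) :
    (overDiag Y).left ≫ starSnd Y Y = 𝟙 Y :=
  homStar_left_snd _

/-- The unit `A ⟶ Y^* A` of the adjunction between `F / Y ⥤ F` and `Y^*`. -/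
def overUnit [HasBinaryProducts F] {Y : F} (A : Over Y) : A ⟶ (Over.star Y).obj A.left :=
  homStar (𝟙 A.left)

theorem overUnit_left_snd [HasBinaryProducts F] {Y : F} (A : Over Y) :
    (overUnit A).left ≫ starSnd Y A.left = 𝟙 _ :=
  homStar_left_snd _

theorem overUnit_naturality [HasBinaryProducts F] {Y : F} {A B : Over Y} (f : A ⟶ B) :
    f ≫ overUnit B = overUnit A ≫ (Over.star Y).map f.left := by
  apply star_over_hom_ext
  rw [Over.comp_left, Over.comp_left, Category.assoc, Category.assoc, overUnit_left_snd,
    star_map_left_snd, reassoc_of% (overUnit_left_snd A), Category.comp_id]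

theorem overUnit_star_map_snd [HasBinaryProducts F] {Y : F} (A : F) :
    overUnit ((Over.star Y).obj A) ≫ (Over.star Y).map (starSnd Y A) = 𝟙 _ := by
  apply star_over_hom_ext
  rw [Over.comp_left, Category.assoc, star_map_left_snd,
    reassoc_of% (overUnit_left_snd ((Over.star Y).obj A)), Over.id_left,
    Category.id_comp]

/-- A point `(y, a)` of `Y × A` lies in the graph of `A ⟶ Y` exactly when its image in `Y × Y` is on
the diagonal. So `A` is a finite limit of objects that a left exact functor sees through `Y^*`. -/
theorem isPullback_overUnit [HasFiniteLimits F] {Y : F} (A : Over Y) :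
    IsPullback (overUnit A) (Over.homMk A.hom : A ⟶ Over.mk (𝟙 Y))
      ((Over.star Y).map A.hom) (overDiag Y) := by
  have w : overUnit A ≫ (Over.star Y).map A.hom =
      (Over.homMk A.hom : A ⟶ Over.mk (𝟙 Y)) ≫ overDiag Y := by
    apply star_over_hom_ext
    rw [Over.comp_left, Over.comp_left, Category.assoc, Category.assoc, star_map_left_snd,
      reassoc_of% (overUnit_left_snd A), overDiag_left_snd]
    exact (Category.comp_id _).symm
  refine ⟨⟨w⟩, ⟨PullbackCone.IsLimit.mk _
    (fun s => Over.homMk (s.fst.left ≫ starSnd Y A.left) ?_) (fun s => ?_) (fun s => ?_)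
    (fun s m hm _ => ?_)⟩⟩
  · have h := congr_arg (fun f => f.left ≫ starSnd Y Y) s.condition
    simp only [Over.comp_left, Category.assoc, star_map_left_snd, overDiag_left_snd] at h
    rw [Category.assoc, h]
    exact Over.w s.snd
  · apply star_over_hom_ext
    rw [Over.comp_left, Category.assoc, overUnit_left_snd, Category.comp_id]
    rfl
  · exact Over.mkIdTerminal.hom_ext _ _
  · ext : 1
    have h := congr_arg (fun f => f.left ≫ starSnd Y A.left) hm
    simp only [Over.comp_left, Category.assoc, overUnit_left_snd, Category.comp_id] at h
    exact h

end

section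

variable {F : Type u₁} [Category.{v₁} F] [HasFiniteLimits F] {Y : F}
  {T : Type u₂} [Category.{v₂} T]

theorem isPullback_map_overUnit (P : Over Y ⥤ T) [PreservesFiniteLimits P] (A : Over Y) :
    IsPullback (P.map (overUnit A))
      (P.map (Over.homMk A.hom : A ⟶ Over.mk (𝟙 Y)))
      (P.map ((Over.star Y).map A.hom)) (P.map (overDiag Y)) :=
  (isPullback_overUnit A).map P

variable {P Q : Over Y ⥤ T} [PreservesFiniteLimits Q]

/-- `Q` preserves the pullback square presenting `A`, and the leg to `Q 1` carries no information
because `Q 1` is terminal. -/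
theorem natTrans_ext_of_star {β β' : P ⟶ Q}
    (h : ∀ A, β.app ((Over.star Y).obj A) = β'.app ((Over.star Y).obj A)) : β = β' := by
  ext A
  apply (isPullback_map_overUnit Q A).hom_ext
  · rw [← β.naturality, ← β'.naturality, h]
  · exact (Over.mkIdTerminal.isTerminalObj Q _).hom_ext _ _

/-- The component at `A` is induced on the pullbacks presenting `P A` and `Q A`. The condition `ht`
says that `γ` respects the generic section; `t` is the only map between these terminal objects. -/
theorem exists_natTrans_of_star [PreservesFiniteLimits P]
    (γ : ∀ A, P.obj ((Over.star Y).obj A) ⟶ Q.obj ((Over.star Y).obj A))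
    (hγ : ∀ {A B : F} (f : A ⟶ B), P.map ((Over.star Y).map f) ≫ γ B =
      γ A ≫ Q.map ((Over.star Y).map f))
    (t : P.obj (Over.mk (𝟙 Y)) ⟶ Q.obj (Over.mk (𝟙 Y)))
    (ht : P.map (overDiag Y) ≫ γ Y = t ≫ Q.map (overDiag Y)) :
    ∃ β : P ⟶ Q, ∀ A, β.app ((Over.star Y).obj A) = γ A := by
  have w (A : Over Y) : (P.map (overUnit A) ≫ γ A.left) ≫ Q.map ((Over.star Y).map A.hom) =
      (P.map (Over.homMk A.hom : A ⟶ Over.mk (𝟙 Y)) ≫ t) ≫ Q.map (overDiag Y) := by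
    have h := (isPullback_map_overUnit P A).w
    rw [Category.assoc, ← hγ, reassoc_of% h, ht, Category.assoc]
  have h1 (A : Over Y) : (isPullback_map_overUnit Q A).lift _ _ (w A) ≫ Q.map (overUnit A) =
    P.map (overUnit A) ≫ γ A.left := IsPullback.lift_fst _ _ _ _
  let β : P ⟶ Q :=
    { app A := (isPullback_map_overUnit Q A).lift _ _ (w A)
      naturality A B f := by
        apply (isPullback_map_overUnit Q B).hom_ext
        · rw [Category.assoc, h1, Category.assoc, ← Q.map_comp, overUnit_naturality, Q.map_comp,
            reassoc_of% (h1 A), ← Functor.map_comp_assoc, overUnit_naturality, P.map_comp,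
            Category.assoc, hγ]
        · exact (Over.mkIdTerminal.isTerminalObj Q _).hom_ext _ _ }
  refine ⟨β, fun A => ?_⟩
  have h2 : β.app ((Over.star Y).obj A) ≫ Q.map (overUnit ((Over.star Y).obj A)) =
    P.map (overUnit ((Over.star Y).obj A)) ≫ γ ((Over.star Y).obj A).left := h1 _
  -- Naturality of `γ` along the projection `Y × A ⟶ A`, whose image under `Y^*` splits the unit at
  -- `Y^* A`, removes the unit from `h2`.
  have h3 : P.map ((Over.star Y).map (starSnd Y A)) ≫ γ A =
      γ ((Over.star Y).obj A).left ≫ Q.map ((Over.star Y).map (starSnd Y A)) := hγ _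
  have h4 := h2 =≫ Q.map ((Over.star Y).map (starSnd Y A))
  rw [Category.assoc, Category.assoc, ← Q.map_comp, ← h3, ← P.map_comp_assoc,
    overUnit_star_map_snd, P.map_id, Q.map_id, Category.comp_id, Category.id_comp] at h4
  exact h4

end

section

variable {F : Type u₁} [Category.{v₁} F] [HasFiniteLimits F] {Y : F}
  {T : Type u₂} [Category.{v₂} T]

/-- A `2`-cell between geometric morphisms to `F / Y` is determined by its composite with
`F / Y ⟶ F`. -/
theorem hom_ext_of_star {x y : GeometricMorphism T (Over Y)} {β β' : x ⟶ y}
    (h : ∀ A, (app β).app ((Over.star Y).obj A) = (app β').app ((Over.star Y).obj A)) :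
    β = β' :=
  haveI := y.preservesFiniteLimits
  hom_ext (natTrans_ext_of_star h)

variable [(Over.star Y).IsLeftAdjoint]

/-- The component of a `2`-cell between the composites with `F / Y ⟶ F`. -/
def starApp {x y : GeometricMorphism T (Over Y)} (γ : x.comp (etale Y) ⟶ y.comp (etale Y))
    (A : F) : x.inverse.obj ((Over.star Y).obj A) ⟶ y.inverse.obj ((Over.star Y).obj A) :=
  (app γ).app A

/-- The lift of a `2`-cell along `F / Y ⟶ F`. -/
theorem exists_postcomp_etale_map_eq {x y : GeometricMorphism T (Over Y)}
    (γ : x.comp (etale Y) ⟶ y.comp (etale Y))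
    (t : x.inverse.obj (Over.mk (𝟙 Y)) ⟶ y.inverse.obj (Over.mk (𝟙 Y)))
    (ht : x.inverse.map (overDiag Y) ≫ starApp γ Y = t ≫ y.inverse.map (overDiag Y)) :
    ∃ β : x ⟶ y, ∀ A, (app β).app ((Over.star Y).obj A) = starApp γ A := by
  have := x.preservesFiniteLimits
  have := y.preservesFiniteLimits
  obtain ⟨β, hβ⟩ := exists_natTrans_of_star (starApp γ) (fun f => (app γ).naturality f) t ht
  exact ⟨homMk β, hβ⟩

/-- The lift of an invertible `2`-cell along `F / Y ⟶ F`. -/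
theorem exists_iso_postcomp_etale_map_eq {x y : GeometricMorphism T (Over Y)}
    (γ : x.comp (etale Y) ≅ y.comp (etale Y))
    (t : x.inverse.obj (Over.mk (𝟙 Y)) ⟶ y.inverse.obj (Over.mk (𝟙 Y)))
    (ht : x.inverse.map (overDiag Y) ≫ starApp γ.hom Y = t ≫ y.inverse.map (overDiag Y)) :
    ∃ β : x ≅ y, ∀ A, (app β.hom).app ((Over.star Y).obj A) = starApp γ.hom A := by
  have := x.preservesFiniteLimits
  have := y.preservesFiniteLimits
  obtain ⟨β, hβ⟩ := exists_postcomp_etale_map_eq γ.hom t ht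
  -- Between terminal objects `t` is invertible, so compatibility with the diagonal passes from
  -- `γ.hom` to `γ.inv`.
  let t' := (Over.mkIdTerminal.isTerminalObj x.inverse _).from
    (y.inverse.obj (Over.mk (𝟙 Y)))
  have ht' : t' ≫ t = 𝟙 _ := (Over.mkIdTerminal.isTerminalObj y.inverse _).hom_ext _ _
  have hγ (A) : starApp γ.hom A ≫ starApp γ.inv A = 𝟙 _ :=
    congr_arg (fun δ => (app δ).app A) γ.hom_inv_id
  have hγ' (A) : starApp γ.inv A ≫ starApp γ.hom A = 𝟙 _ :=
    congr_arg (fun δ => (app δ).app A) γ.inv_hom_id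
  obtain ⟨β', hβ'⟩ := exists_postcomp_etale_map_eq γ.inv t' (by
    have h := t' ≫= ht =≫ starApp γ.inv Y
    simp only [Category.assoc] at h
    rw [hγ, reassoc_of% ht', Category.comp_id] at h
    exact h.symm)
  refine ⟨⟨β, β', hom_ext_of_star fun A => ?_, hom_ext_of_star fun A => ?_⟩, hβ⟩
  · rw [app_comp, NatTrans.comp_app, hβ, hβ', hγ]; rfl
  · rw [app_comp, NatTrans.comp_app, hβ, hβ', hγ']; rfl

end

end GeometricMorphism

/-! ### The square of slices induced by a geometric morphism, and its comparison functor. -/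

namespace GeometricMorphism

section

variable {E : Type u₁} [Category.{v₁} E] {F : Type u₂} [Category.{v₂} F]

/-- A functor preserving binary products commutes with `A ↦ (Y × A ⟶ Y)`. -/
def starCompPostIso [HasBinaryProducts E] [HasBinaryProducts F] (L : F ⥤ E)
    [PreservesLimitsOfShape (Discrete WalkingPair) L] (Y : F) :
    Over.star Y ⋙ Over.post L ≅ L ⋙ Over.star (L.obj Y) :=
  NatIso.ofComponents
    (fun A =>
      -- The underlying map is the product comparison `L (Y × A) ⟶ L Y × L A`.
      haveI : IsIso ((Over.forget _).map (homStar (Z := (Over.post L).obj ((Over.star Y).obj A))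
          (L.map (starSnd Y A)))) := by
        rw [Over.forget_map]
        have h : (homStar (Z := (Over.post L).obj ((Over.star Y).obj A))
          (L.map (starSnd Y A))).left = prodComparison L Y A := by
          change prod.lift (L.map ((Over.star Y).obj A).hom) _ = _
          rw [star_obj_hom]
          rfl
        rw [h]
        exact inferInstanceAs (IsIso (prodComparison L Y A))
      haveI : IsIso (homStar (Z := (Over.post L).obj ((Over.star Y).obj A))
          (L.map (starSnd Y A))) := isIso_of_reflects_iso _ (Over.forget _)
      asIso (homStar (Z := (Over.post L).obj ((Over.star Y).obj A)) (L.map (starSnd Y A))))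
    (fun {A B} f => by
      apply star_over_hom_ext
      have h1 := star_map_left_snd (L.obj Y) (L.map f)
      have h2 := star_map_left_snd Y f
      have h3 := homStar_left_snd (Z := (Over.post L).obj ((Over.star Y).obj A))
        (L.map (starSnd Y A))
      have h4 := homStar_left_snd (Z := (Over.post L).obj ((Over.star Y).obj B))
        (L.map (starSnd Y B))
      have h5 := congr_arg L.map h2
      rw [L.map_comp, L.map_comp] at h5
      refine (Category.assoc _ _ _).trans ((_ ≫= h4).trans ?_)
      exact h5.trans (((Category.assoc _ _ _).trans
        ((_ ≫= h1).trans ((Category.assoc _ _ _).symm.trans (h3 =≫ _)))).symm))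

theorem starCompPostIso_hom_app_left_snd [HasBinaryProducts E] [HasBinaryProducts F] (L : F ⥤ E)
    [PreservesLimitsOfShape (Discrete WalkingPair) L] (Y A : F) :
    ((starCompPostIso L Y).hom.app A).left ≫ starSnd (L.obj Y) (L.obj A) =
      L.map (starSnd Y A) :=
  homStar_left_snd _

/-- Preserving products entails preserving diagonals. The map `k` bridges the two terminal objects
`𝟙 (L Y)` and `L (𝟙 Y)`, which need not be definitionally equal. -/
theorem overDiag_comp_starCompPostIso [HasBinaryProducts E] [HasBinaryProducts F] (L : F ⥤ E)
    [PreservesLimitsOfShape (Discrete WalkingPair) L] (Y : F)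
    (k : Over.mk (𝟙 (L.obj Y)) ⟶ (Over.post L).obj (Over.mk (𝟙 Y))) :
    k ≫ (Over.post L).map (overDiag Y) ≫ (starCompPostIso L Y).hom.app Y =
      overDiag (L.obj Y) := by
  apply star_over_hom_ext
  have h1 := starCompPostIso_hom_app_left_snd L Y Y
  have h2 := congr_arg L.map (overDiag_left_snd Y)
  rw [L.map_comp] at h2
  have h3 : k.left ≫ L.map (𝟙 Y) = 𝟙 (L.obj Y) := Over.w k
  refine (Category.assoc _ _ _).trans ((_ ≫= Category.assoc _ _ _).trans
    ((_ ≫= _ ≫= h1).trans ?_))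
  exact (_ ≫= h2).trans (h3.trans (overDiag_left_snd _).symm)

end

section

variable {E : Type u₁} [Category.{v₁} E] {F : Type u₂} [Category.{v₂} F]
  [HasFiniteLimits E] [HasFiniteLimits F] {f : GeometricMorphism E F} {Y : F}

variable (f Y) in
/-- The component of `sliceEtaleIso`. -/
def sliceEtaleApp (A : F) : (Over.post f.inverse).obj ((Over.star Y).obj A) ≅
    (Over.star (f.inverse.obj Y)).obj (f.inverse.obj A) :=
  haveI := f.preservesFiniteLimits
  (starCompPostIso f.inverse Y).app A

theorem overDiag_comp_sliceEtaleApp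
    (k : Over.mk (𝟙 (f.inverse.obj Y)) ⟶ (Over.post f.inverse).obj (Over.mk (𝟙 Y))) :
    k ≫ (Over.post f.inverse).map (overDiag Y) ≫ (sliceEtaleApp f Y Y).hom =
      overDiag (f.inverse.obj Y) :=
  haveI := f.preservesFiniteLimits
  overDiag_comp_starCompPostIso f.inverse Y k

/-- The canonical isomorphism between the terminal objects of `E / f^* Y`. -/
def postTerminalIso : Over.mk (𝟙 (f.inverse.obj Y)) ≅ (Over.post f.inverse).obj (Over.mk (𝟙 Y)) :=
  Over.isoMk (Iso.refl _) (by
    refine (Category.id_comp _).trans ?_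
    exact f.inverse.map_id Y)

end

section

variable {E : Type u₁} [Category.{v₁} E] {F : Type u₂} [Category.{v₂} F]
  [HasFiniteLimits E] [HasFiniteLimits F] (f : GeometricMorphism E F) (Y : F)
  [(Over.star Y).IsLeftAdjoint] [(Over.star (f.inverse.obj Y)).IsLeftAdjoint]

/-- The square formed by `f : E ⟶ F` and the induced geometric morphism `E / f^* Y ⟶ F / Y`
commutes. -/
def sliceEtaleIso : (f.slice Y).comp (etale Y) ≅ (etale (f.inverse.obj Y)).comp f :=
  haveI := f.preservesFiniteLimits
  isoMk (starCompPostIso f.inverse Y)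

variable {f Y} {T : Type u₃} [Category.{v₃} T]

/-- The component at `A` of a `2`-cell between geometric morphisms to `F`, the first of which
factors through `F / Y`. -/
def appStar {x : GeometricMorphism T (Over Y)} {g : GeometricMorphism T F}
    (γ : x.comp (etale Y) ⟶ g) (A : F) :
    x.inverse.obj ((Over.star Y).obj A) ⟶ g.inverse.obj A :=
  (app γ).app A

end

section

variable {E : Type u₁} [Category.{v₁} E] {F : Type u₂} [Category.{v₂} F]
  [HasFiniteLimits E] [HasFiniteLimits F] (f : GeometricMorphism E F) (Y : F)
  [(Over.star Y).IsLeftAdjoint] [(Over.star (f.inverse.obj Y)).IsLeftAdjoint]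
  {T : Type u₃} [Category.{v₃} T]

/-- The component over `E` alone already determines a `2`-cell. -/
theorem comparison_faithful : (comparison (sliceEtaleIso f Y) T).Faithful where
  map_injective {x y β β'} h := by
    apply hom_ext_of_star
    intro A
    exact congr_arg (fun γ => (app (CategoricalPullback.Hom.snd γ)).app A) h

/-- The component over `E` lifts to `E/f^*Y` once it respects the generic section. That section is
the image under `f^*` of the one in `F/Y`, which the component over `F/Y` respects by naturality. -/
theorem comparison_full : (comparison (sliceEtaleIso f Y) T).Full where
  map_surjective {x y} m := by
    let m₁ (A : Over Y) : x.inverse.obj ((Over.post f.inverse).obj A) ⟶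
      y.inverse.obj ((Over.post f.inverse).obj A) := (app m.fst).app A
    have m₁_nat {A B : Over Y} (u : A ⟶ B) : x.inverse.map ((Over.post f.inverse).map u) ≫ m₁ B =
      m₁ A ≫ y.inverse.map ((Over.post f.inverse).map u) := (app m.fst).naturality u
    have hm (A : F) : m₁ ((Over.star Y).obj A) ≫ y.inverse.map (sliceEtaleApp f Y A).hom =
        x.inverse.map (sliceEtaleApp f Y A).hom ≫ starApp m.snd (f.inverse.obj A) := by
      have h : m₁ ((Over.star Y).obj A) ≫ 𝟙 _ ≫ y.inverse.map (sliceEtaleApp f Y A).hom ≫ 𝟙 _ =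
        (𝟙 _ ≫ x.inverse.map (sliceEtaleApp f Y A).hom ≫ 𝟙 _) ≫ starApp m.snd (f.inverse.obj A) :=
        congr_arg (fun γ => (app γ).app A) m.w
      simpa only [Category.id_comp, Category.comp_id] using h
    have hk := overDiag_comp_sliceEtaleApp (f := f) (Y := Y) postTerminalIso.hom
    obtain ⟨β, hβ⟩ := exists_postcomp_etale_map_eq m.snd
      (x.inverse.map postTerminalIso.hom ≫ m₁ _ ≫ y.inverse.map postTerminalIso.inv) (by
        rw [← hk]
        simp only [Functor.map_comp, Category.assoc]
        rw [← hm, reassoc_of% (m₁_nat (overDiag Y)), ← y.inverse.map_comp_assoc,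
          Iso.inv_hom_id, y.inverse.map_id, Category.id_comp])
    refine ⟨β, CategoricalPullback.Hom.ext ?_ ?_⟩
    · apply hom_ext_of_star
      intro A
      change (app β).app ((Over.post f.inverse).obj ((Over.star Y).obj A)) =
        m₁ ((Over.star Y).obj A)
      rw [← cancel_mono (y.inverse.map (sliceEtaleApp f Y A).hom), hm, ← hβ,
        (app β).naturality]
    · ext A
      exact hβ A

/-- The hypothesis `H` is the existence half of the classifying property of `E/f^*Y`. It is applied
to `g₂` and to the section of `g₂^* f^* Y` obtained by carrying the generic section of `F/Y` through
`g₁` and `θ`. -/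
theorem comparison_essSurj
    (H : ∀ (g : GeometricMorphism T E) {S : T} (_ : IsTerminal S)
      (s : S ⟶ g.inverse.obj (f.inverse.obj Y)),
      ∃ (x : GeometricMorphism T (Over (f.inverse.obj Y)))
        (φ : x.comp (etale (f.inverse.obj Y)) ≅ g)
        (t : x.inverse.obj (Over.mk (𝟙 _)) ⟶ S),
        x.inverse.map (overDiag (f.inverse.obj Y)) ≫ appStar φ.hom _ = t ≫ s) :
    (comparison (sliceEtaleIso f Y) T).EssSurj where
  mem_essImage := by
    rintro ⟨g₁, g₂, θ⟩
    have := g₁.preservesFiniteLimits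
    obtain ⟨x, φ, t, h⟩ := H g₂ (Over.mkIdTerminal.isTerminalObj g₁.inverse _)
      (g₁.inverse.map (overDiag Y) ≫ appStar θ.hom Y)
    let ψ : (x.comp (f.slice Y)).comp (etale Y) ≅ g₁.comp (etale Y) :=
      assoc _ _ _ ≪≫ (precomp x F).mapIso (sliceEtaleIso f Y) ≪≫ (assoc _ _ _).symm ≪≫
        (postcomp T f).mapIso φ ≪≫ θ.symm
    let θ' (A : F) : g₂.inverse.obj (f.inverse.obj A) ⟶ g₁.inverse.obj ((Over.star Y).obj A) :=
      (app θ.inv).app A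
    let θ₁ (A : F) : g₁.inverse.obj ((Over.star Y).obj A) ⟶ g₂.inverse.obj (f.inverse.obj A) :=
      appStar θ.hom A
    have h : x.inverse.map (overDiag (f.inverse.obj Y)) ≫ appStar φ.hom _ =
      t ≫ g₁.inverse.map (overDiag Y) ≫ θ₁ Y := h
    have hθ (A : F) : θ₁ A ≫ θ' A = 𝟙 _ :=
      congr_arg (fun γ => (app γ).app A) θ.hom_inv_id
    have hψ (A : F) : starApp ψ.hom A = x.inverse.map (sliceEtaleApp f Y A).hom ≫
        appStar φ.hom (f.inverse.obj A) ≫ θ' A := by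
      have : starApp ψ.hom A = 𝟙 _ ≫ x.inverse.map (sliceEtaleApp f Y A).hom ≫ 𝟙 _ ≫
        appStar φ.hom (f.inverse.obj A) ≫ θ' A := rfl
      simpa only [Category.id_comp] using this
    -- By the choice of section, `x` followed by `f.slice Y` and `g₁` pick out the same section, so
    -- `ψ` lifts to `F/Y`.
    obtain ⟨β, hβ⟩ := exists_iso_postcomp_etale_map_eq ψ
      (x.inverse.map postTerminalIso.inv ≫ t) (by
        rw [hψ Y]
        have hk := postTerminalIso.inv ≫=
          overDiag_comp_sliceEtaleApp (f := f) (Y := Y) postTerminalIso.hom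
        rw [Iso.inv_hom_id_assoc] at hk
        have hk' := congr_arg x.inverse.map hk
        rw [x.inverse.map_comp, x.inverse.map_comp] at hk'
        have key : x.inverse.map ((Over.post f.inverse).map (overDiag Y)) ≫
            x.inverse.map (sliceEtaleApp f Y Y).hom ≫ appStar φ.hom _ ≫ θ' Y =
            (x.inverse.map postTerminalIso.inv ≫ t) ≫ g₁.inverse.map (overDiag Y) := by
          rw [reassoc_of% hk', reassoc_of% h, hθ, Category.comp_id, Category.assoc]
        exact key)
    refine ⟨x, ⟨CategoricalPullback.mkIso β φ ?_⟩⟩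
    ext A
    have hθ' : θ' A ≫ θ₁ A = 𝟙 _ := congr_arg (fun γ => (app γ).app A) θ.inv_hom_id
    have key : (x.inverse.map (sliceEtaleApp f Y A).hom ≫
        appStar φ.hom (f.inverse.obj A) ≫ θ' A) ≫ θ₁ A =
        x.inverse.map (sliceEtaleApp f Y A).hom ≫ appStar φ.hom (f.inverse.obj A) := by
      rw [Category.assoc, Category.assoc, hθ', Category.comp_id]
    change _ = (𝟙 _ ≫ x.inverse.map (sliceEtaleApp f Y A).hom ≫ 𝟙 _) ≫
      appStar φ.hom (f.inverse.obj A)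
    simp only [Category.id_comp, Category.comp_id]
    exact ((hβ A).trans (hψ A) =≫ θ₁ A).trans key

end

end GeometricMorphism

/-! ### Slices of a left exact reflective subcategory -/

section

theorem isIso_map_unit {E : Type u₁} [Category.{v₁} E] {F : Type u₂} [Category.{v₂} F]
    {L : F ⥤ E} {R : E ⥤ F} (adj : L ⊣ R) [R.Full] [R.Faithful] (X : F) :
    IsIso (L.map (adj.unit.app X)) := by
  have h := adj.left_triangle_components X
  have : IsIso (L.map (adj.unit.app X) ≫ adj.counit.app (L.obj X)) := by
    rw [h]; exact IsIso.id _
  exact IsIso.of_isIso_comp_right _ (adj.counit.app (L.obj X))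

variable {E : Type u₁} [Category.{v₁} E] {F : Type u₂} [Category.{v₂} F] [HasFiniteLimits F]
  {L : F ⥤ E} {R : E ⥤ F} (adj : L ⊣ R)

/-- The inclusion of the slice over `L X` in the slice over `X`. -/
def overInclusion (X : F) : Over (L.obj X) ⥤ Over X :=
  Over.post R ⋙ Over.pullback (adj.unit.app X)

/-- The adjunction between the slice over `X` and the slice over `L X`. -/
def overPostAdjunction (X : F) : Over.post L ⊣ overInclusion adj X :=
  Over.postAdjunctionLeft adj

/-- The projection from the underlying object of `overInclusion`. -/
def overInclusionFst (X : F) (A : Over (L.obj X)) :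
    ((overInclusion adj X).obj A).left ⟶ R.obj A.left :=
  pullback.fst (R.map A.hom) (adj.unit.app X)

theorem isPullback_overInclusion (X : F) (A : Over (L.obj X)) :
    IsPullback (overInclusionFst adj X A) ((overInclusion adj X).obj A).hom
      (R.map A.hom) (adj.unit.app X) :=
  IsPullback.of_hasPullback (R.map A.hom) (adj.unit.app X)

theorem overInclusion_map_fst (X : F) {A B : Over (L.obj X)} (f : A ⟶ B) :
    ((overInclusion adj X).map f).left ≫ overInclusionFst adj X B =
      overInclusionFst adj X A ≫ R.map f.left :=
  pullback.lift_fst _ _ _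

variable [PreservesFiniteLimits L] [R.Full] [R.Faithful]

/-- The component of the counit of the reflection of a slice onto the slice of a reflective
subcategory. -/
def overPostCounitApp (X : F) (A : Over (L.obj X)) :
    (Over.post L).obj ((overInclusion adj X).obj A) ⟶ A :=
  Over.homMk (L.map (overInclusionFst adj X A) ≫ adj.counit.app A.left) (by
    have h1 : adj.counit.app A.left ≫ A.hom = L.map (R.map A.hom) ≫ adj.counit.app (L.obj X) :=
      (adj.counit.naturality A.hom).symm
    have h2 := adj.left_triangle_components X
    have h3 := ((isPullback_overInclusion adj X A).map L).w
    have key : (L.map (overInclusionFst adj X A) ≫ adj.counit.app A.left) ≫ A.hom =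
        L.map ((overInclusion adj X).obj A).hom := by
      rw [Category.assoc, h1, reassoc_of% h3, h2]
      exact Category.comp_id _
    exact key)

/-- The projection to `R A` is a pullback of the unit at `X`. `L` inverts that unit and preserves
the pullback, so it inverts the projection; the counit of `adj` is invertible too. -/
theorem isIso_overPostCounitApp (X : F) (A : Over (L.obj X)) :
    IsIso (overPostCounitApp adj X A) := by
  have := isIso_map_unit adj X
  have : IsIso (L.map (overInclusionFst adj X A)) :=
    ((isPullback_overInclusion adj X A).map L).isIso_fst_of_isIso
  have : IsIso ((Over.forget _).map (overPostCounitApp adj X A)) :=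
    inferInstanceAs (IsIso (L.map (overInclusionFst adj X A) ≫ adj.counit.app A.left))
  exact isIso_of_reflects_iso _ (Over.forget _)

/-- The slice over `L X` is a retract of the slice over `X`. -/
def overPostCounitIso (X : F) :
    overInclusion adj X ⋙ Over.post L ≅ 𝟭 (Over (L.obj X)) :=
  NatIso.ofComponents
    (fun A => haveI := isIso_overPostCounitApp adj X A
      asIso (overPostCounitApp adj X A))
    (fun {A B} f => by
      ext : 1
      have h1 : adj.counit.app A.left ≫ f.left = L.map (R.map f.left) ≫ adj.counit.app B.left :=
        (adj.counit.naturality f.left).symm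
      have h3 := congr_arg L.map (overInclusion_map_fst adj X f)
      rw [L.map_comp, L.map_comp] at h3
      have key : L.map ((overInclusion adj X).map f).left ≫
        L.map (overInclusionFst adj X B) ≫ adj.counit.app B.left =
          (L.map (overInclusionFst adj X A) ≫ adj.counit.app A.left) ≫ f.left := by
        rw [reassoc_of% h3, Category.assoc, h1]
      exact key)

/-- The slice over `L X` is a reflective subcategory of the slice over `X`. -/
@[reducible]
def overReflective (X : F) : Reflective (overInclusion adj X) :=
  haveI : IsIso (overPostAdjunction adj X).counit :=
    Adjunction.isIso_counit_of_iso _ (overPostCounitIso adj X)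
  haveI ff := (overPostAdjunction adj X).fullyFaithfulROfIsIsoCounit
  { toFull := ff.full
    toFaithful := ff.faithful
    L := Over.post L
    adj := overPostAdjunction adj X }

include adj in
theorem isLocalization_overPost (X : F) :
    (Over.post (X := X) L).IsLocalization
      ((MorphismProperty.isomorphisms _).inverseImage (Over.post (X := X) L)) :=
  let := overReflective adj X
  (overPostAdjunction adj X).isLocalization

end

/-! ### Slices of Grothendieck toposes -/

section

/-- The property that every slice is cartesian closed. -/
def HasCartesianClosedSlices (E : Type u) [Category.{v} E] [HasFiniteLimits E] : Prop :=
  ∀ (X : E) [CartesianMonoidalCategory (Over X)], Nonempty (MonoidalClosed (Over X))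

theorem presheaf_hasCartesianClosedSlices (C : Type w) [SmallCategory C] :
    HasCartesianClosedSlices (Cᵒᵖ ⥤ Type w) := fun X _ =>
  ⟨cartesianClosedOfEquiv (overEquivPresheafCostructuredArrow X).symm⟩

theorem HasCartesianClosedSlices.of_equivalence {E : Type u₁} [Category.{v₁} E]
    [HasFiniteLimits E] {F : Type u₂} [Category.{v₂} F] [HasFiniteLimits F]
    (hF : HasCartesianClosedSlices F) (e : E ≌ F) : HasCartesianClosedSlices E := fun X _ => by
  let : CartesianMonoidalCategory (Over (e.functor.obj X)) := .ofHasFiniteProducts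
  obtain ⟨_⟩ := hF (e.functor.obj X)
  exact ⟨cartesianClosedOfEquiv (Over.postEquiv X e).symm⟩

/-- Every `X` is isomorphic to `L (R X)`, and the slice over it is a left exact reflective
subcategory of the slice over `R X`, hence an exponential ideal. -/
theorem HasCartesianClosedSlices.of_reflection {E : Type u₁} [Category.{v} E]
    [HasFiniteLimits E] {F : Type u₂} [Category.{v} F] [HasFiniteLimits F]
    (hF : HasCartesianClosedSlices F) {L : F ⥤ E} {R : E ⥤ F} (adj : L ⊣ R)
    [PreservesFiniteLimits L] [R.Full] [R.Faithful] : HasCartesianClosedSlices E := fun X _ => by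
  let : CartesianMonoidalCategory (Over (R.obj X)) := .ofHasFiniteProducts
  let : CartesianMonoidalCategory (Over (L.obj (R.obj X))) := .ofHasFiniteProducts
  obtain ⟨_⟩ := hF (R.obj X)
  let := overReflective adj (R.obj X)
  have : PreservesFiniteLimits (reflector (overInclusion adj (R.obj X))) :=
    GeometricMorphism.preservesFiniteLimits_post L (R.obj X)
  let : MonoidalClosed (Over (L.obj (R.obj X))) :=
    cartesianClosedOfReflective (overInclusion adj (R.obj X))
  exact ⟨cartesianClosedOfEquiv
    (Over.mapIso (asIso (adj.counit.app X) : L.obj (R.obj X) ≅ X))⟩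

variable {T : Type u} [Category.{v} T] [IsGrothendieckTopos.{w} T]

variable (T) in
include T in
theorem IsGrothendieckTopos.hasFiniteLimits : HasFiniteLimits T := by
  obtain ⟨C, _, J, ⟨e⟩⟩ := IsGrothendieckTopos.exists_site.{w} (E := T)
  exact ⟨fun I _ _ => Adjunction.hasLimitsOfShape_of_equivalence e.functor⟩

theorem IsGrothendieckTopos.hasCartesianClosedSlices [HasFiniteLimits T] :
    HasCartesianClosedSlices T := by
  obtain ⟨C, _, J, ⟨e⟩⟩ := IsGrothendieckTopos.exists_site.{w} (E := T)
  exact ((presheaf_hasCartesianClosedSlices C).of_reflection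
    (sheafificationAdjunction J (Type w))).of_equivalence e

theorem IsGrothendieckTopos.star_over_isLeftAdjoint [HasFiniteLimits T] {X : T} (S : Over X) :
    (Over.star S).IsLeftAdjoint := by
  let : CartesianMonoidalCategory (Over X) := .ofHasFiniteProducts
  obtain ⟨_⟩ := IsGrothendieckTopos.hasCartesianClosedSlices.{w} X
  exact star_isLeftAdjoint S

theorem IsGrothendieckTopos.of_equivalence {E : Type u₁} [Category.{v₁} E] (e : E ≌ T) :
    IsGrothendieckTopos.{w} E where
  exists_site := by
    obtain ⟨C, _, J, ⟨e'⟩⟩ := IsGrothendieckTopos.exists_site.{w} (E := T)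
    exact ⟨C, inferInstance, J, ⟨e.trans e'⟩⟩

end

/-! ### The classifying property of slice toposes and the resulting `2`-pullback. -/

namespace GeometricMorphism

variable {E : Type u₁} [Category.{v₁} E] [HasFiniteLimits E] {Y : E}
  {T : Type u₂} [Category.{v₂} T]

/-- The geometric morphism `T ⟶ E / Y` given by a geometric morphism `g : T ⟶ E` and a global
section of `g^* Y`. -/
theorem exists_lift_of_section [IsGrothendieckTopos.{w} T] [(Over.star Y).IsLeftAdjoint]
    (g : GeometricMorphism T E) {S : T} (hS : IsTerminal S) (s : S ⟶ g.inverse.obj Y) :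
    ∃ (x : GeometricMorphism T (Over Y)) (φ : x.comp (etale Y) ≅ g)
      (t : x.inverse.obj (Over.mk (𝟙 Y)) ⟶ S),
      x.inverse.map (overDiag Y) ≫ appStar φ.hom Y = t ≫ s := by
  have := IsGrothendieckTopos.hasFiniteLimits.{w} T
  let S' : Over (g.inverse.obj Y) := Over.mk s
  have := IsGrothendieckTopos.star_over_isLeftAdjoint.{w} S'
  -- Regarded as an object of `T/g^*Y`, the section has slice `T/S`, which is `T` as `S` is
  -- terminal. The lift is therefore `T ≃ (T/g^*Y)/S' ⟶ T/g^*Y ⟶ E/Y`.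
  let ε : Over S' ≌ T := (Over.iteratedSliceEquiv S').trans (Over.equivalenceOfIsTerminal hS)
  let x : GeometricMorphism T (Over Y) :=
    (ofEquivalence ε.symm).comp ((etale S').comp (g.slice Y))
  have := g.preservesFiniteLimits
  -- The left adjoint is the functor underlying `ε`, so the counit is invertible and identifies the
  -- composite `T ⟶ E` with `g`.
  let adj := (Over.forgetAdjStar S').comp (Over.forgetAdjStar (g.inverse.obj Y))
  have : (Over.forget S' ⋙ Over.forget (g.inverse.obj Y)).IsEquivalence :=
    ε.isEquivalence_functor
  have := adj.isEquivalence_right_of_isEquivalence_left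
  let φ : x.comp (etale Y) ≅ g :=
    isoMk (Functor.isoWhiskerRight (starCompPostIso g.inverse Y)
      (Over.star S' ⋙ Over.forget S' ⋙ Over.forget (g.inverse.obj Y)) ≪≫
        Functor.isoWhiskerLeft g.inverse (asIso adj.counit))
  let P := (Over.post g.inverse).obj (Over.mk (𝟙 Y))
  have hφ : appStar φ.hom Y = ((Over.star S').map (sliceEtaleApp g Y Y).hom).left.left ≫
      (starSnd S' ((Over.star (g.inverse.obj Y)).obj (g.inverse.obj Y))).left ≫
        starSnd (g.inverse.obj Y) (g.inverse.obj Y) := by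
    have h := Adjunction.comp_counit_app (Over.forgetAdjStar S')
      (Over.forgetAdjStar (g.inverse.obj Y)) (g.inverse.obj Y)
    have h1 : (Over.forgetAdjStar S').counit.app
        ((Over.star (g.inverse.obj Y)).obj (g.inverse.obj Y)) = starSnd S' _ :=
      Over.forgetAdjStar_counit_app _ _
    have h2 : (Over.forgetAdjStar (g.inverse.obj Y)).counit.app (g.inverse.obj Y) =
      starSnd (g.inverse.obj Y) _ := Over.forgetAdjStar_counit_app _ _
    exact _ ≫= (h.trans (by rw [h1, h2]; rfl))
  refine ⟨x, φ, ((Over.star S').obj P).hom.left, ?_⟩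
  have h1 : ((Over.star S').map ((Over.post g.inverse).map (overDiag Y))).left.left ≫
      (starSnd S' ((Over.post g.inverse).obj ((Over.star Y).obj Y))).left =
      (starSnd S' P).left ≫ ((Over.post g.inverse).map (overDiag Y)).left :=
    congr_arg (fun f => f.left) (star_map_left_snd S' ((Over.post g.inverse).map (overDiag Y)))
  have h2 : ((Over.star S').map (sliceEtaleApp g Y Y).hom).left.left ≫
      (starSnd S' ((Over.star (g.inverse.obj Y)).obj (g.inverse.obj Y))).left =
      (starSnd S' ((Over.post g.inverse).obj ((Over.star Y).obj Y))).left ≫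
        (sliceEtaleApp g Y Y).hom.left :=
    congr_arg (fun f => f.left) (star_map_left_snd S' (sliceEtaleApp g Y Y).hom)
  have h3 : ((Over.post g.inverse).map (overDiag Y)).left ≫ (sliceEtaleApp g Y Y).hom.left =
      (overDiag (g.inverse.obj Y)).left :=
    (Category.id_comp _).symm.trans
      (congr_arg (fun f => f.left)
        (overDiag_comp_sliceEtaleApp (f := g) (Y := Y) postTerminalIso.hom))
  have h4 := overDiag_left_snd (g.inverse.obj Y)
  have h5 : ((Over.star S').obj P).hom.left ≫ s = ((Over.star S').obj P).left.hom :=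
    Over.w ((Over.star S').obj P).hom
  have h6 : (starSnd S' P).left ≫ g.inverse.map (𝟙 Y) = ((Over.star S').obj P).left.hom :=
    Over.w (starSnd S' P)
  have key : ((Over.star S').map ((Over.post g.inverse).map (overDiag Y))).left.left ≫
      ((Over.star S').map (sliceEtaleApp g Y Y).hom).left.left ≫
      (starSnd S' ((Over.star (g.inverse.obj Y)).obj (g.inverse.obj Y))).left ≫
        starSnd (g.inverse.obj Y) (g.inverse.obj Y) = ((Over.star S').obj P).left.hom := by
    rw [reassoc_of% h2, reassoc_of% h1, reassoc_of% h3]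
    refine (_ ≫= h4).trans ?_
    exact (_ ≫= (g.inverse.map_id Y).symm).trans h6
  exact (_ ≫= hφ).trans (key.trans h5.symm)

theorem isTwoPullback_sliceEtaleIso {E : Type u₁} [Category.{v₁} E] {F : Type u₂} [Category.{v₂} F]
    [HasFiniteLimits E] [HasFiniteLimits F] (f : GeometricMorphism E F) (Y : F)
    [(Over.star Y).IsLeftAdjoint] [(Over.star (f.inverse.obj Y)).IsLeftAdjoint] :
    IsTwoPullback.{w, v, u} (sliceEtaleIso f Y) := fun _ _ _ =>
  { faithful := comparison_faithful f Y
    full := comparison_full f Y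
    essSurj := comparison_essSurj f Y fun g _ hS s => exists_lift_of_section.{w} g hS s }

/-! ### Invariance under equivalence -/

section

universe v₅ u₅

variable {P : Type u₁} [Category.{v₁} P] {A : Type u₂} [Category.{v₂} A]
  {B : Type u₃} [Category.{v₃} B] {D : Type u₄} [Category.{v₄} D]

/-- Composition with an equivalence is an equivalence. -/
theorem postcomp_ofEquivalence_isEquivalence (e : A ≌ B) (T : Type u) [Category.{v} T] :
    (postcomp T (ofEquivalence e)).IsEquivalence :=
  (CategoryTheory.Equivalence.mk (postcomp T (ofEquivalence e)) (postcomp T (ofEquivalence e.symm))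
    (NatIso.ofComponents
      (fun x => isoMk (x.inverse.leftUnitor.symm ≪≫ Functor.isoWhiskerRight e.unitIso x.inverse ≪≫
        Functor.associator _ _ _))
      (fun {x y} β => by
        ext X
        change (app β).app X ≫ 𝟙 _ ≫ y.inverse.map (e.unitIso.hom.app X) ≫ 𝟙 _ =
          (𝟙 _ ≫ x.inverse.map (e.unitIso.hom.app X) ≫ 𝟙 _) ≫
            (app β).app (e.inverse.obj (e.functor.obj X))
        simp only [Category.id_comp, Category.comp_id]
        exact ((app β).naturality _).symm))
    (NatIso.ofComponents
      (fun x => isoMk ((Functor.associator _ _ _).symm ≪≫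
        Functor.isoWhiskerRight e.counitIso x.inverse ≪≫ x.inverse.leftUnitor))
      (fun {x y} β => by
        ext X
        change (app β).app (e.functor.obj (e.inverse.obj X)) ≫
            𝟙 _ ≫ y.inverse.map (e.counitIso.hom.app X) ≫ 𝟙 _ =
          (𝟙 _ ≫ x.inverse.map (e.counitIso.hom.app X) ≫ 𝟙 _) ≫ (app β).app X
        simp only [Category.id_comp, Category.comp_id]
        exact ((app β).naturality _).symm))).isEquivalence_functor

/-- The comparison functors of a square and of its composite with an equivalence are isomorphic. -/
def comparisonCompIso {Q : Type u} [Category.{v} Q]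
    {p : GeometricMorphism P A} {q : GeometricMorphism P B}
    {f : GeometricMorphism A D} {g : GeometricMorphism B D} (α : p.comp f ≅ q.comp g)
    (e : GeometricMorphism Q P) {q' : GeometricMorphism Q B} (θ : q' ≅ e.comp q)
    (T : Type*) [Category* T] :
    postcomp T e ⋙ comparison α T ≅
      comparison (assoc e p f ≪≫ (precomp e D).mapIso α ≪≫ (assoc e q g).symm ≪≫
      (postcomp Q g).mapIso θ.symm) T :=
  NatIso.ofComponents
    (fun x => CategoricalPullback.mkIso (assoc x e p)
      (assoc x e q ≪≫ (precomp x B).mapIso θ.symm) (by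
        ext d
        change 𝟙 _ ≫ 𝟙 _ ≫ x.inverse.map (𝟙 _ ≫ e.inverse.map ((app α.hom).app d) ≫ 𝟙 _ ≫
            (app θ.inv).app (g.inverse.obj d)) ≫ 𝟙 _ =
          (𝟙 _ ≫ x.inverse.map (e.inverse.map ((app α.hom).app d)) ≫ 𝟙 _) ≫
            𝟙 _ ≫ x.inverse.map ((app θ.inv).app (g.inverse.obj d))
        simp only [Category.id_comp, Category.comp_id, Functor.map_comp]
        exact _ ≫= congr_arg x.inverse.map (Category.id_comp _)))
    (fun {x y} β => by
      apply CategoricalPullback.Hom.ext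
      · ext a
        change (app β).app _ ≫ 𝟙 _ = 𝟙 _ ≫ (app β).app _
        exact (Category.comp_id _).trans (Category.id_comp _).symm
      · ext b
        change (app β).app _ ≫ 𝟙 _ ≫ y.inverse.map ((app θ.inv).app b) =
          (𝟙 _ ≫ x.inverse.map ((app θ.inv).app b)) ≫ (app β).app _
        rw [Category.id_comp, Category.id_comp]
        exact ((app β).naturality _).symm)

theorem IsTwoPullback.of_equivalence {Q : Type u} [Category.{v} Q]
    {p : GeometricMorphism P A} {q : GeometricMorphism P B}
    {f : GeometricMorphism A D} {g : GeometricMorphism B D} {α : p.comp f ≅ q.comp g}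
    (hα : IsTwoPullback.{w, v₅, u₅} α) (e : Q ≌ P) {q' : GeometricMorphism Q B}
    (θ : q' ≅ (ofEquivalence e).comp q) :
    ∃ β : ((ofEquivalence e).comp p).comp f ≅ q'.comp g, IsTwoPullback.{w, v₅, u₅} β := by
  refine ⟨assoc (ofEquivalence e) p f ≪≫ (precomp (ofEquivalence e) D).mapIso α ≪≫
    (assoc (ofEquivalence e) q g).symm ≪≫ (postcomp Q g).mapIso θ.symm, fun T _ _ => ?_⟩
  have := hα T
  have := postcomp_ofEquivalence_isEquivalence e T
  exact Functor.isEquivalence_of_iso (comparisonCompIso α (ofEquivalence e) θ T)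

end

end GeometricMorphism

/-! ### Pushouts along the legs of a filtered colimit -/

section

variable {ℬ : Type u} [Category.{w} ℬ] {J : Type w} [SmallCategory J] {D : J ⥤ ℬ}
  {c : Cocone D} (hc : IsColimit c) [HasPushouts ℬ] {j : J} {K' : ℬ} (l : D.obj j ⟶ K')

/-- The pushouts of `l : D j ⟶ K'` along the maps `D j ⟶ D k`. -/
def pushoutDiagram : Under j ⥤ ℬ := Under.post D ⋙ Under.pushout l ⋙ Under.forget K'

/-- The map from `D k` to the pushout of `l` along `D j ⟶ D k`. -/
def pushoutDiagramInl (k : Under j) : D.obj k.right ⟶ (pushoutDiagram l).obj k :=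
  pushout.inl (D.map k.hom) l

/-- The map from `K'` to the pushout of `l` along `D j ⟶ D k`. -/
def pushoutDiagramInr (k : Under j) : K' ⟶ (pushoutDiagram l).obj k :=
  pushout.inr (D.map k.hom) l

theorem isPushout_pushoutDiagram (k : Under j) :
    IsPushout l (D.map k.hom) (pushoutDiagramInr l k) (pushoutDiagramInl l k) :=
  (IsPushout.of_hasPushout (D.map k.hom) l).flip

theorem pushoutDiagramInr_map {k k' : Under j} (f : k ⟶ k') :
    pushoutDiagramInr l k ≫ (pushoutDiagram l).map f = pushoutDiagramInr l k' :=
  pushout.inr_desc _ _ _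

variable {l} {C : ℬ} {c' : K' ⟶ C} {n : c.pt ⟶ C} (h : IsPushout l (c.ι.app j) c' n)

/-- The cocone over `pushoutDiagram` whose point is the pushout of `l` along `D j ⟶ c.pt`. -/
def pushoutDiagramCocone : Cocone (pushoutDiagram l) :=
  ((Under.pushout l ⋙ Under.forget K').mapCocone (c.underPost j)).extend h.flip.isoPushout.inv

/-- The legs of `pushoutDiagramCocone`. -/
def pushoutDiagramLeg (k : Under j) : (pushoutDiagram l).obj k ⟶ C :=
  (pushoutDiagramCocone h).ι.app k

theorem pushoutDiagramInr_leg (k : Under j) :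
    pushoutDiagramInr l k ≫ pushoutDiagramLeg h k = c' :=
  (pushout.inr_desc_assoc _ _ _ _).trans h.flip.inr_isoPushout_inv

theorem pushoutDiagramInl_leg (k : Under j) :
    pushoutDiagramInl l k ≫ pushoutDiagramLeg h k = c.ι.app k.right ≫ n :=
  (pushout.inl_desc_assoc _ _ _ _).trans
    ((Category.assoc _ _ _).trans (_ ≫= h.flip.inl_isoPushout_inv))

theorem isPushout_pushoutDiagramInl (k : Under j) :
    IsPushout (pushoutDiagramInl l k) (c.ι.app k.right) (pushoutDiagramLeg h k) n := by
  refine IsPushout.of_top ?_ (pushoutDiagramInl_leg h k) (isPushout_pushoutDiagram l k)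
  have hk : D.map k.hom ≫ c.ι.app k.right = c.ι.app j := c.w k.hom
  rw [pushoutDiagramInr_leg]
  exact hk ▸ h

include hc

/-- Pushout between coslices is a left adjoint; filteredness permits passing to the coslice under `D
j` and forgetting the coslice under `K'`. -/
theorem nonempty_isColimit_pushoutDiagramCocone [IsFiltered J] :
    Nonempty (IsColimit (pushoutDiagramCocone h)) := by
  have : PreservesColimitsOfSize.{w, w} (Under.pushout l) :=
    (Under.mapPushoutAdj l).leftAdjoint_preservesColimits
  have : IsIso h.flip.isoPushout.inv := inferInstance
  exact ⟨@IsColimit.extendIso _ _ _ _ _ ((Under.pushout l ⋙ Under.forget K').mapCocone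
    (c.underPost j)) _ h.flip.isoPushout.inv this
    (isColimitOfPreserves (Under.pushout l ⋙ Under.forget K') (hc.underPost j))⟩

include h

/-- A map from a finitely presentable object to the pushout of `l : D j ⟶ K'` along `D j ⟶ c.pt`
factors through the pushout of `l` along some `D j ⟶ D k`. -/
theorem exists_factor_pushout [IsFiltered J] {L : ℬ} [IsFinitelyPresentable.{w} L] (b : L ⟶ C) :
    ∃ (k : J) (u : j ⟶ k) (P : ℬ) (i₁ : K' ⟶ P) (i₂ : D.obj k ⟶ P) (d : P ⟶ C)
      (b' : L ⟶ P), IsPushout l (D.map u) i₁ i₂ ∧ IsPushout i₂ (c.ι.app k) d n ∧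
        i₁ ≫ d = c' ∧ b' ≫ d = b := by
  obtain ⟨hc'⟩ := nonempty_isColimit_pushoutDiagramCocone hc h
  obtain ⟨k, b', hb'⟩ := IsFinitelyPresentable.exists_hom_of_isColimit hc' b
  exact ⟨k.right, k.hom, _, _, _, _, b', isPushout_pushoutDiagram l k,
    isPushout_pushoutDiagramInl h k, pushoutDiagramInr_leg h k, hb'⟩

/-- Two maps from a finitely presentable object to `K'` that are equal in the pushout of
`l : D j ⟶ K'` along `D j ⟶ c.pt` are equal in the pushout of `l` along some `D j ⟶ D k`. -/
theorem exists_eq_pushout [IsFiltered J] {L : ℬ} [IsFinitelyPresentable.{w} L] (f g : L ⟶ K')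
    (hfg : f ≫ c' = g ≫ c') :
    ∃ (k : J) (u : j ⟶ k) (P : ℬ) (i₁ : K' ⟶ P) (i₂ : D.obj k ⟶ P) (d : P ⟶ C),
      IsPushout l (D.map u) i₁ i₂ ∧ IsPushout i₂ (c.ι.app k) d n ∧
        i₁ ≫ d = c' ∧ f ≫ i₁ = g ≫ i₁ := by
  obtain ⟨hc'⟩ := nonempty_isColimit_pushoutDiagramCocone hc h
  have e (f : L ⟶ K') (k : Under j) : (f ≫ pushoutDiagramInr l k) ≫ pushoutDiagramLeg h k =
      f ≫ c' := by rw [Category.assoc, pushoutDiagramInr_leg]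
  obtain ⟨k, u, v, huv⟩ := IsFinitelyPresentable.exists_eq_of_isColimit hc'
    (f ≫ pushoutDiagramInr l (Under.mk (𝟙 j))) (g ≫ pushoutDiagramInr l (Under.mk (𝟙 j)))
    ((e f _).trans (hfg.trans (e g _).symm))
  refine ⟨k.right, k.hom, _, _, _, _, isPushout_pushoutDiagram l k,
    isPushout_pushoutDiagramInl h k, pushoutDiagramInr_leg h k, ?_⟩
  simpa only [Category.assoc, pushoutDiagramInr_map] using huv

end

/-! ### Composition and cancellation of etale arrows. -/

namespace Geometry

variable {ℬ : Type u} [Category.{w} ℬ] {𝒢 : Geometry ℬ}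

/-- The arrow `n : B ⟶ C` is a finitely presented etale arrow under `B`. -/
def Etale (𝒢 : Geometry ℬ) {B C : ℬ} (n : B ⟶ C) : Prop := 𝒢.IsFPEtale B (Under.mk n)

theorem Etale.of_isPushout {B C B' C' : ℬ} {n : B ⟶ C} {f : B ⟶ B'} {g : C ⟶ C'} {n' : B' ⟶ C'}
    (hn : 𝒢.Etale n) (h : IsPushout n f g n') : 𝒢.Etale n' := by
  obtain ⟨K, K', l, a, c, hl, h'⟩ := hn
  exact ⟨K, K', l, a ≫ f, c ≫ g, hl, IsPushout.paste_vert h' h⟩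

theorem etale_of_maps {K K' : ℬ} {l : K ⟶ K'} (hl : 𝒢.𝒱.maps l) : 𝒢.Etale l :=
  ⟨K, K', l, 𝟙 K, 𝟙 K', hl, IsPushout.of_vert_isIso ⟨by simp⟩⟩

variable [IsLocallyFinitelyPresentable.{w} ℬ]

variable (ℬ) in
theorem exists_isColimit_finPres (B : ℬ) : ∃ (J : Type w) (_ : SmallCategory J) (_ : IsFiltered J)
    (D : J ⥤ ℬ) (ι : D ⟶ (Functor.const J).obj B), (∀ j, IsFinitelyPresentable.{w} (D.obj j)) ∧
      Nonempty (IsColimit (Cocone.mk B ι)) := by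
  have : Fact (Cardinal.aleph0.{w}).IsRegular := ⟨Cardinal.isRegular_aleph0⟩
  obtain ⟨J, _, hJ, ⟨p⟩⟩ :=
    (isCardinalFilteredGenerator_isCardinalPresentable ℬ Cardinal.aleph0.{w}).exists_colimitsOfShape
      B
  exact ⟨J, inferInstance, isFiltered_of_isCardinalFiltered J Cardinal.aleph0.{w}, p.diag, p.ι,
    p.prop_diag_obj, ⟨p.isColimit⟩⟩

/-- An etale map is a pushout of a map in `𝒱` along a leg of a given filtered colimit. -/
theorem Etale.exists_stage {J : Type w} [SmallCategory J] [IsFiltered J] {D : J ⥤ ℬ}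
    {c : Cocone D} (hc : IsColimit c) (hD : ∀ j, IsFinitelyPresentable.{w} (D.obj j)) {C : ℬ}
    {n : c.pt ⟶ C} (hn : 𝒢.Etale n) :
    ∃ (j : J) (K' : ℬ) (l : D.obj j ⟶ K') (c' : K' ⟶ C),
      𝒢.𝒱.maps l ∧ IsPushout l (c.ι.app j) c' n := by
  obtain ⟨K, K', l, a, c', hl, h⟩ := hn
  have := 𝒢.𝒱.source_mem l hl
  obtain ⟨j, a', rfl⟩ := IsFinitelyPresentable.exists_hom_of_isColimit hc a
  have h' := (IsPushout.of_hasPushout l a')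
  exact ⟨j, _, _, _, 𝒢.𝒱.pushout_mem h' (hD j) hl, IsPushout.of_top' h h'⟩

/-- `C` is a filtered colimit of finite stages of `n`, and the map `b : L ⟶ C` along which `m` is a
pushout factors through one of them. There the two maps of `𝒱` become composable. -/
theorem Etale.comp {B C C' : ℬ} {n : B ⟶ C} {m : C ⟶ C'} (hn : 𝒢.Etale n) (hm : 𝒢.Etale m) :
    𝒢.Etale (n ≫ m) := by
  obtain ⟨J, _, _, D, ι, hD, ⟨hc⟩⟩ := exists_isColimit_finPres ℬ B
  obtain ⟨j, K', l, c', hl, h⟩ := hn.exists_stage hc hD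
  obtain ⟨L, L', l', b, b', hl', h'⟩ := hm
  have := 𝒢.𝒱.source_mem l' hl'
  obtain ⟨k, u, P, i₁, i₂, d, b₀, hP, hd, -, rfl⟩ := exists_factor_pushout hc h b
  have hi₂ := 𝒢.𝒱.pushout_mem hP (hD k) hl
  have hQ := IsPushout.of_hasPushout l' b₀
  exact (etale_of_maps (𝒢.𝒱.comp_mem _ _ hi₂
    (𝒢.𝒱.pushout_mem hQ (𝒢.𝒱.target_mem _ hi₂) hl'))).of_isPushout
      (hd.paste_horiz (IsPushout.of_top' h' hQ))

/-- At a late enough stage `m` descends to a map `f` between finite stages of `n` and `n ≫ m`;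
cancellation in `𝒱` applies to `f`, of which `m` is a pushout. -/
theorem Etale.of_comp {B C C' : ℬ} {n : B ⟶ C} {m : C ⟶ C'} (hn : 𝒢.Etale n)
    (hnm : 𝒢.Etale (n ≫ m)) : 𝒢.Etale m := by
  obtain ⟨J, _, _, D, ι, hD, ⟨hc⟩⟩ := exists_isColimit_finPres ℬ B
  -- both maps are pushouts of maps with the same source
  obtain ⟨j₁, K₁, l₁, c₁, hl₁, h₁⟩ := hn.exists_stage hc hD
  obtain ⟨j₂, K₂, l₂, c₂, hl₂, h₂⟩ := hnm.exists_stage hc hD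
  have push {j k : J} {K M : ℬ} {l : D.obj j ⟶ K} {c : K ⟶ M} {n : B ⟶ M} (u : j ⟶ k)
      (hl : 𝒢.𝒱.maps l) (h : IsPushout l (ι.app j) c n) :
      ∃ (P : ℬ) (p : D.obj k ⟶ P) (c' : P ⟶ M), 𝒢.𝒱.maps p ∧ IsPushout p (ι.app k) c' n := by
    have h' := IsPushout.of_hasPushout l (D.map u)
    have hu : D.map u ≫ ι.app k = ι.app j := (Cocone.mk B ι).w u
    exact ⟨_, _, _, 𝒢.𝒱.pushout_mem h' (hD k) hl, IsPushout.of_top' (by rwa [hu]) h'⟩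
  obtain ⟨P, p, x, hp, hP⟩ := push (IsFiltered.leftToMax j₁ j₂) hl₁ h₁
  obtain ⟨Q, q, y, hq, hQ⟩ := push (IsFiltered.rightToMax j₁ j₂) hl₂ h₂
  generalize IsFiltered.max j₁ j₂ = j at p x hp hP q y hq hQ
  -- the map `P ⟶ C ⟶ C'` factors through a stage
  have := 𝒢.𝒱.target_mem p hp
  have := hD j
  obtain ⟨k, u, Q', i₁, i₂, d, b, hQ', hd, rfl, hb⟩ := exists_factor_pushout hc hQ (x ≫ m)
  -- The factorization `b` need not be a map under `D j`; the two maps from `D j` agree in `C'`,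
  -- hence at a later stage `k'`.
  obtain ⟨k', v, Q'', i₁', i₂', d', hQ'', hd', rfl, e⟩ := exists_eq_pushout hc hd
    (p ≫ b) (D.map u ≫ i₂) (by
      have hu : D.map u ≫ ι.app k = ι.app j := (Cocone.mk B ι).w u
      have h₁ : p ≫ x = ι.app j ≫ n := hP.w
      have h₂ : i₂ ≫ d = ι.app k ≫ n ≫ m := hd.w
      rw [Category.assoc, hb, reassoc_of% h₁, Category.assoc, h₂, reassoc_of% hu])
  have hP' := IsPushout.of_hasPushout p (D.map (u ≫ v))
  have huv : D.map (u ≫ v) ≫ ι.app k' = ι.app j := (Cocone.mk B ι).w (u ≫ v)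
  have hx₀ : p ≫ x = D.map (u ≫ v) ≫ ι.app k' ≫ n := by rw [reassoc_of% huv]; exact hP.w
  have hx : IsPushout _ _ (hP'.desc x (ι.app k' ≫ n) hx₀) n :=
    IsPushout.of_top' (v₂₁ := ι.app k') (by rwa [huv]) hP'
  have w : p ≫ b ≫ i₁' = D.map (u ≫ v) ≫ i₂' := by
    rw [← Category.assoc, e, Category.assoc, hQ''.w, D.map_comp, Category.assoc]
  let f : pushout p (D.map (u ≫ v)) ⟶ Q'' := pushout.desc _ _ w
  have hf : 𝒢.𝒱.maps f := by
    refine 𝒢.𝒱.cancel (pushout.inr _ _) f (𝒢.𝒱.pushout_mem hP' (hD k') hp) ?_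
    rw [pushout.inr_desc]
    exact 𝒢.𝒱.pushout_mem hQ'' (hD k') (𝒢.𝒱.pushout_mem hQ' (hD k) hq)
  have hf₁ : pushout.inl _ _ ≫ f = b ≫ i₁' := pushout.inl_desc _ _ _
  have hf₂ : pushout.inr _ _ ≫ f = i₂' := pushout.inr_desc _ _ _
  have hx₁ : pushout.inl _ _ ≫ hP'.desc x (ι.app k' ≫ n) hx₀ = x := hP'.inl_desc _ _ _
  refine (etale_of_maps hf).of_isPushout (IsPushout.of_left (?_ : IsPushout _ _ d' _) ?_ hx)
  · rw [hf₂]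
    exact hd'
  · apply pushout.hom_ext
    · rw [reassoc_of% hf₁, reassoc_of% hx₁, hb]
    · have hx₂ : pushout.inr _ _ ≫ hP'.desc x (ι.app k' ≫ n) hx₀ = ι.app k' ≫ n :=
        hP'.inr_desc _ _ _
      rw [reassoc_of% hf₂, reassoc_of% hx₂]
      exact hd'.w

end Geometry

/-! ### Slices of presheaf categories over representable presheaves -/

section

variable {T : Type u₁} [Category.{w} T] {S : Type u₂} [Category.{w} S] {X : T} (V : S ⥤ Over X)

/-- The functor to the category of elements of `yoneda.obj X` given by a functor to `Over X`. -/
def toCostructuredArrowYoneda : S ⥤ CostructuredArrow yoneda (yoneda.obj X) :=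
  V ⋙ CostructuredArrow.post (𝟭 T) yoneda X

/-- The presheaf on `S` given by a presheaf over `yoneda.obj X`. -/
def overYonedaRestrict : Over (yoneda.obj X) ⥤ Sᵒᵖ ⥤ Type w :=
  (overEquivPresheafCostructuredArrow (yoneda.obj X)).functor ⋙
    (Functor.whiskeringLeft _ _ (Type w)).obj (toCostructuredArrowYoneda V).op

namespace overYonedaRestrict

variable {V}

/-- The underlying element of a section of `overYonedaRestrict`. -/
def val {P : Over (yoneda.obj X)} {d : S} (x : ((overYonedaRestrict V).obj P).obj (op d)) :
    P.left.obj (op (V.obj d).left) :=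
  OverPresheafAux.OverArrows.val x

theorem val_injective {P : Over (yoneda.obj X)} {d : S}
    {x y : ((overYonedaRestrict V).obj P).obj (op d)} (h : val x = val y) : x = y :=
  OverPresheafAux.OverArrows.ext h

theorem hom_app_val {P : Over (yoneda.obj X)} {d : S}
    (x : ((overYonedaRestrict V).obj P).obj (op d)) :
    P.hom.app _ (val x) = (V.obj d).hom :=
  (OverPresheafAux.OverArrows.app_val x).trans (yonedaEquiv_yoneda_map _)

theorem exists_val_eq {P : Over (yoneda.obj X)} {d : S} (x : P.left.obj (op (V.obj d).left))
    (h : P.hom.app _ x = (V.obj d).hom) :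
    ∃ y : ((overYonedaRestrict V).obj P).obj (op d), val y = x :=
  ⟨⟨x, ⟨h.trans (yonedaEquiv_yoneda_map _).symm⟩⟩, rfl⟩

end overYonedaRestrict

variable [V.IsEquivalence]

instance : (toCostructuredArrowYoneda V).IsEquivalence :=
  let W : Over X ⥤ CostructuredArrow yoneda (yoneda.obj X) := CostructuredArrow.post (𝟭 T) yoneda X
  have : W.IsEquivalence := CostructuredArrow.isEquivalence_post _ _ _
  inferInstanceAs (V ⋙ W).IsEquivalence

instance : (overYonedaRestrict V).IsEquivalence :=
  inferInstanceAs ((overEquivPresheafCostructuredArrow (yoneda.obj X)).functor ⋙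
    (Functor.whiskeringLeft _ _ (Type w)).obj (toCostructuredArrowYoneda V).op).IsEquivalence

theorem exists_iso_left {Z : T} (s : Z ⟶ X) :
    ∃ (d : S) (i : Z ≅ (V.obj d).left), i.hom ≫ (V.obj d).hom = s :=
  ⟨V.objPreimage (Over.mk s), ((Over.forget X).mapIso (V.objObjPreimageIso (Over.mk s))).symm,
    Over.w (V.objObjPreimageIso (Over.mk s)).inv⟩

open Presheaf overYonedaRestrict

/-- `P(U)` is the disjoint union of its fibres over the maps `U ⟶ X`, and up to isomorphism each
such map is some `V d`. -/
theorem exists_eq_map_val {P : Over (yoneda.obj X)} {U : T} (x : P.left.obj (op U)) :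
    ∃ (d : S) (i : U ≅ (V.obj d).left) (x' : ((overYonedaRestrict V).obj P).obj (op d)),
      P.left.map i.hom.op (val x') = x := by
  obtain ⟨d, i, hi⟩ := exists_iso_left V (Z := U) (P.hom.app _ x)
  obtain ⟨x', hx'⟩ := exists_val_eq (V := V) (P := P) (d := d) (P.left.map i.inv.op x) (by
    rw [NatTrans.naturality_apply, ← hi]
    exact i.inv_hom_id_assoc _)
  refine ⟨d, i, x', ?_⟩
  rw [hx', ← ConcreteCategory.comp_apply, ← P.left.map_comp, ← op_comp, i.hom_inv_id, op_id,
    P.left.map_id]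
  rfl

theorem exists_eq_map_val₂ {P : Over (yoneda.obj X)} {U : T} (x y : P.left.obj (op U))
    (h : P.hom.app _ x = P.hom.app _ y) :
    ∃ (d : S) (i : U ≅ (V.obj d).left) (x' y' : ((overYonedaRestrict V).obj P).obj (op d)),
      P.left.map i.hom.op (val x') = x ∧ P.left.map i.hom.op (val y') = y := by
  obtain ⟨d, i, x', rfl⟩ := exists_eq_map_val V x
  obtain ⟨y', hy'⟩ := exists_val_eq (V := V) (P := P) (d := d) (P.left.map i.inv.op y) (by
    rw [NatTrans.naturality_apply, ← h, NatTrans.naturality_apply, hom_app_val]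
    exact i.inv_hom_id_assoc _)
  refine ⟨d, i, x', y', rfl, ?_⟩
  rw [hy', ← ConcreteCategory.comp_apply, ← P.left.map_comp, ← op_comp, i.hom_inv_id, op_id,
    P.left.map_id]
  rfl

variable {J : GrothendieckTopology T} {K : GrothendieckTopology S}
  (hJ : ∀ (d : S) (R : Sieve (V.obj d).left), R ∈ J (V.obj d).left →
    R.functorPullback (V ⋙ Over.forget X) ∈ K d)
  (hK : CoverPreserving K J (V ⋙ Over.forget X))

include hJ hK

/-- Sections with the same image lie in the same fibre, so injectivity can be tested on `S`. `hK`
carries covers to `T` and `hJ` brings them back. -/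
theorem isLocallyInjective_overYonedaRestrict_map_iff {P Q : Over (yoneda.obj X)} (φ : P ⟶ Q) :
    IsLocallyInjective K ((overYonedaRestrict V).map φ) ↔ IsLocallyInjective J φ.left := by
  constructor
  · intro h
    refine ⟨fun {U} x y hxy => ?_⟩
    induction U using Opposite.rec with | op U
    have hxy' : P.hom.app _ x = P.hom.app _ y := by
      rw [← Over.w φ, NatTrans.comp_app, ConcreteCategory.comp_apply, ConcreteCategory.comp_apply,
        hxy]
    obtain ⟨d, i, x', y', rfl, rfl⟩ := exists_eq_map_val₂ V x y hxy'
    have hi : Function.Injective (Q.left.map i.hom.op) := injective_of_mono (Q.left.map i.hom.op)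
    have h' : ((overYonedaRestrict V).map φ).app (op d) x' =
        ((overYonedaRestrict V).map φ).app (op d) y' :=
      val_injective (hi (by
        rw [NatTrans.naturality_apply, NatTrans.naturality_apply] at hxy
        exact hxy))
    refine J.superset_covering ?_ (J.pullback_stable i.hom
      (hK.cover_preserve (equalizerSieve_mem K ((overYonedaRestrict V).map φ) x' y' h')))
    rintro Z f ⟨d', g, a, hg, hf⟩
    change Z ⟶ (V.obj d').left at a
    have hg' : P.left.map (V.map g).left.op (val x') = P.left.map (V.map g).left.op (val y') :=
      congr_arg val hg
    have hf' (z : P.left.obj (op (V.obj d).left)) : P.left.map f.op (P.left.map i.hom.op z) =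
        P.left.map a.op (P.left.map (V.map g).left.op z) := by
      rw [← ConcreteCategory.comp_apply, ← ConcreteCategory.comp_apply, ← P.left.map_comp,
        ← P.left.map_comp, ← op_comp, ← op_comp]
      exact congr_arg (fun f => P.left.map f.op z) hf
    exact (hf' _).trans ((congr_arg _ hg').trans (hf' _).symm)
  · intro h
    refine ⟨fun {d} x y hxy => ?_⟩
    refine K.superset_covering ?_ (hJ d.unop _ (equalizerSieve_mem J φ.left (val x) (val y)
      (congr_arg val hxy)))
    intro d' f hf
    exact val_injective hf

theorem isLocallySurjective_overYonedaRestrict_map_iff {P Q : Over (yoneda.obj X)} (φ : P ⟶ Q) :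
    IsLocallySurjective K ((overYonedaRestrict V).map φ) ↔ IsLocallySurjective J φ.left := by
  constructor
  · intro h
    refine ⟨fun {U} x => ?_⟩
    obtain ⟨d, i, x', rfl⟩ := exists_eq_map_val V x
    refine J.superset_covering ?_ (J.pullback_stable i.hom
      (hK.cover_preserve (imageSieve_mem K ((overYonedaRestrict V).map φ) x')))
    rintro Z f ⟨d', g, a, ⟨y, hy⟩, hf⟩
    change Z ⟶ (V.obj d').left at a
    have hy' : φ.left.app _ (val y) = Q.left.map (V.map g).left.op (val x') := congr_arg val hy
    refine ⟨P.left.map a.op (val y), ?_⟩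
    rw [NatTrans.naturality_apply]
    refine (congr_arg (Q.left.map a.op) hy').trans ?_
    rw [← ConcreteCategory.comp_apply, ← ConcreteCategory.comp_apply, ← Q.left.map_comp,
      ← Q.left.map_comp, ← op_comp, ← op_comp]
    exact congr_arg (fun f => Q.left.map f.op (val x')) hf.symm
  · intro h
    refine ⟨fun {d} x => ?_⟩
    refine K.superset_covering ?_ (hJ d _ (imageSieve_mem J φ.left (val x)))
    rintro d' f ⟨y, hy⟩
    change P.left.obj (op (V.obj d').left) at y
    change φ.left.app _ y = Q.left.map (V.map f).left.op (val x) at hy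
    -- A preimage in `P` lies automatically in the right fibre, because `φ` is a map over
    -- `yoneda.obj X`.
    obtain ⟨z, rfl⟩ := exists_val_eq (V := V) (P := P) (d := d') y (by
      have hφ : P.hom.app (op (V.obj d').left) y = Q.hom.app _ (φ.left.app _ y) := by
        rw [← Over.w φ, NatTrans.comp_app, ConcreteCategory.comp_apply]
      rw [hφ]
      refine (congr_arg _ hy).trans ?_
      rw [NatTrans.naturality_apply]
      refine (congr_arg _ (hom_app_val x)).trans ?_
      exact Over.w (V.map f))
    exact ⟨z, val_injective hy⟩

end

/-! ### The slice topos and the sheaf topos as localizations at the same maps. -/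

section

variable {T : Type u₁} [Category.{w} T] [EssentiallySmall.{w} T] {S : Type u₂} [Category.{w} S]
  [EssentiallySmall.{w} S] {X : T} (V : S ⥤ Over X) [V.IsEquivalence]
  {J : GrothendieckTopology T} {K : GrothendieckTopology S}
  (hJ : ∀ (d : S) (R : Sieve (V.obj d).left), R ∈ J (V.obj d).left →
    R.functorPullback (V ⋙ Over.forget X) ∈ K d)
  (hK : CoverPreserving K J (V ⋙ Over.forget X))
  [HasSheafify J (Type w)] [HasSheafify K (Type w)]

/-- Restriction of presheaves over `yoneda.obj X`, followed by sheafification. -/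
def overYonedaToSheaf : Over (yoneda.obj X) ⥤ Sheaf K (Type w) :=
  overYonedaRestrict V ⋙ presheafToSheaf K (Type w)

include hJ hK in
-- Sheafification inverts exactly the locally bijective maps, and local bijectivity means the same
-- for both topologies.
theorem isIso_overYonedaToSheaf_map_iff {P Q : Over (yoneda.obj X)} (φ : P ⟶ Q) :
    IsIso ((overYonedaToSheaf V (K := K)).map φ) ↔
      IsIso ((Over.post (presheafToSheaf J (Type w))).map φ) := by
  have : J.WEqualsLocallyBijective (Type w) := .ofEssentiallySmall.{w} J
  have : K.WEqualsLocallyBijective (Type w) := .ofEssentiallySmall.{w} K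
  have h₁ : IsIso ((Over.post (presheafToSheaf J (Type w))).map φ) ↔
      IsIso ((presheafToSheaf J (Type w)).map φ.left) :=
    ⟨fun _ => inferInstanceAs (IsIso ((Over.forget _).map
      ((Over.post (presheafToSheaf J (Type w))).map φ))), fun h =>
      have : IsIso ((Over.forget _).map ((Over.post (presheafToSheaf J (Type w))).map φ)) := h
      isIso_of_reflects_iso _ (Over.forget _)⟩
  have h₂ : IsIso ((overYonedaToSheaf V (K := K)).map φ) ↔ K.W ((overYonedaRestrict V).map φ) :=
    (K.W_iff _).symm
  rw [h₁, h₂, ← J.W_iff, J.W_iff_isLocallyBijective, K.W_iff_isLocallyBijective,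
    isLocallyInjective_overYonedaRestrict_map_iff V hJ hK,
    isLocallySurjective_overYonedaRestrict_map_iff V hJ hK]

instance isLocalization_overYonedaToSheaf : (overYonedaToSheaf V (K := K)).IsLocalization
    ((MorphismProperty.isomorphisms _).inverseImage (overYonedaToSheaf V (K := K))) :=
  ((overYonedaRestrict V).asEquivalence.toAdjunction.comp
    (sheafificationAdjunction K (Type w))).isLocalization

include hJ hK in
theorem isLocalization_overPost_presheafToSheaf :
    (Over.post (X := yoneda.obj X) (presheafToSheaf J (Type w))).IsLocalization
    ((MorphismProperty.isomorphisms _).inverseImage (overYonedaToSheaf V (K := K))) := by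
  have h : (MorphismProperty.isomorphisms _).inverseImage (overYonedaToSheaf V (K := K)) =
      (MorphismProperty.isomorphisms _).inverseImage
        (Over.post (X := yoneda.obj X) (presheafToSheaf J (Type w))) := by
    ext P Q φ
    exact isIso_overYonedaToSheaf_map_iff V hJ hK φ
  rw [h]
  exact isLocalization_overPost (sheafificationAdjunction J (Type w)) _

/-- Sheaves over the sheaf associated to `X` are sheaves on `S`, for `S` equivalent to the slice
over `X`. -/
def overSheafEquivalence :
    Over ((presheafToSheaf J (Type w)).obj (yoneda.obj X)) ≌ Sheaf K (Type w) :=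
  haveI := isLocalization_overPost_presheafToSheaf V hJ hK
  Localization.uniq (Over.post (X := yoneda.obj X) (presheafToSheaf J (Type w)))
    (overYonedaToSheaf V (K := K))
    ((MorphismProperty.isomorphisms _).inverseImage (overYonedaToSheaf V (K := K)))

/-- The compatibility of `overSheafEquivalence` with sheafification. -/
def postCompOverSheafEquivalence :
    Over.post (X := yoneda.obj X) (presheafToSheaf J (Type w)) ⋙
      (overSheafEquivalence V hJ hK).functor ≅ overYonedaToSheaf V (K := K) :=
  haveI := isLocalization_overPost_presheafToSheaf V hJ hK
  Localization.compUniqFunctor (Over.post (X := yoneda.obj X) (presheafToSheaf J (Type w)))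
    (overYonedaToSheaf V (K := K))
    ((MorphismProperty.isomorphisms _).inverseImage (overYonedaToSheaf V (K := K)))

end

/-! ### Products with a representable presheaf, seen on the slice site. -/

section

variable {T : Type u₁} [Category.{w} T] {S : Type u₂} [Category.{w} S] {X : T} (V : S ⥤ Over X)

open GeometricMorphism overYonedaRestrict

/-- The presheaf on `S` given by the product of `yoneda.obj X` and a presheaf `P` is the restriction
of `P`. -/
def starCompOverYonedaRestrict : Over.star (yoneda.obj X) ⋙ overYonedaRestrict V ⟶
    (Functor.whiskeringLeft _ _ (Type w)).obj (V ⋙ Over.forget X).op where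
  app P :=
    { app := fun d => ↾fun x => (starSnd (yoneda.obj X) P).app _ (val (d := d.unop) x)
      naturality := fun d d' f => by
        ext x
        exact NatTrans.naturality_apply (starSnd (yoneda.obj X) P) (V.map f.unop).left.op
          (val (d := d.unop) x) }
  naturality P Q φ := by
    ext d x
    have h := star_map_left_snd (yoneda.obj X) φ
    exact ConcreteCategory.congr_hom (NatTrans.congr_app h (op (V.obj d.unop).left))
      (val (d := d.unop) x)

/-- In a section of `yoneda.obj X × P` over `V d` the first coordinate is forced to be the structure
map, so only a section of `P` remains. -/
instance : IsIso (starCompOverYonedaRestrict V) := by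
  rw [NatTrans.isIso_iff_isIso_app]
  intro P
  rw [NatTrans.isIso_iff_isIso_app]
  intro d
  rw [isIso_iff_bijective]
  induction d using Opposite.rec with | op d
  constructor
  · intro x y hxy
    apply val_injective (d := d)
    apply yonedaEquiv.symm.injective
    apply star_hom_ext
    · apply yonedaEquiv.injective
      rw [yonedaEquiv_comp, yonedaEquiv_comp, Equiv.apply_symm_apply, Equiv.apply_symm_apply]
      exact (hom_app_val x).trans (hom_app_val y).symm
    · apply yonedaEquiv.injective
      rw [yonedaEquiv_comp, yonedaEquiv_comp, Equiv.apply_symm_apply, Equiv.apply_symm_apply]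
      exact hxy
  · intro p
    let s : Over.mk (yoneda.map (V.obj d).hom) ⟶ (Over.star (yoneda.obj X)).obj P :=
      homStar (yonedaEquiv.symm p)
    obtain ⟨x, hx⟩ := exists_val_eq (V := V) (P := (Over.star (yoneda.obj X)).obj P) (d := d)
      (yonedaEquiv s.left) (by
        rw [← yonedaEquiv_comp, Over.w s]
        exact yonedaEquiv_yoneda_map _)
    refine ⟨x, (congr_arg _ hx).trans ?_⟩
    exact (yonedaEquiv_comp s.left _).symm.trans
      ((congr_arg yonedaEquiv (homStar_left_snd _)).trans (Equiv.apply_symm_apply _ _))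

/-- The presheaf on `S` given by the product of `yoneda.obj X` and a representable presheaf is
representable. -/
def yonedaCompStarIso {p : T ⥤ S} (adj : V ⋙ Over.forget X ⊣ p) :
    yoneda ⋙ Over.star (yoneda.obj X) ⋙ overYonedaRestrict V ≅ p ⋙ yoneda :=
  Functor.isoWhiskerLeft yoneda (asIso (starCompOverYonedaRestrict V)) ≪≫ adj.compYonedaIso.symm

end

/-! ### Left Kan extensions along the sheafified Yoneda embedding -/

section

variable {C : Type u₁} [Category.{w} C] {E : Type u₂} [Category.{v₂} E]
  {L : (Cᵒᵖ ⥤ Type w) ⥤ E} {R : E ⥤ Cᵒᵖ ⥤ Type w} (adj : L ⊣ R) [R.Full] [R.Faithful]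
  {H : Type u₃} [Category.{v₃} H]

include adj in
/-- A left adjoint functor `F` is the left Kan extension of its restriction along the composite of
the Yoneda embedding with a reflection. -/
theorem isLeftKanExtension_yoneda_comp (F : E ⥤ H) [F.IsLeftAdjoint] :
    F.IsLeftKanExtension (𝟙 ((yoneda ⋙ L) ⋙ F)) := by
  have := adj.isLeftAdjoint
  -- The identity is the Kan extension of Yoneda along itself, and the cocontinuous `L ⋙ F`
  -- preserves it.
  have h₁ : ((𝟭 _) ⋙ (L ⋙ F)).IsLeftKanExtension
      (Functor.whiskerRight (Functor.rightUnitor (yoneda (C := C))).inv (L ⋙ F) ≫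
        (Functor.associator _ _ _).hom) := by
    have : PreservesColimitsOfSize.{w, max w u₁} (L ⋙ F) :=
      (Adjunction.ofIsLeftAdjoint (L ⋙ F)).leftAdjoint_preservesColimits
    have : (L ⋙ F).PreservesLeftKanExtension yoneda (yoneda (C := C)) := inferInstance
    exact Functor.PreservesLeftKanExtension.preserves _ _
  have h₂ : (L ⋙ F).IsLeftKanExtension (𝟙 ((yoneda (C := C)) ⋙ L ⋙ F)) := by
    refine (Functor.isLeftKanExtension_iff_of_iso (Functor.leftUnitor _) _ _ ?_).1 h₁
    ext X : 2
    simp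
  have := adj.isLocalization
  -- `L` is a localization, so `F` extends `L ⋙ F` along `L`; the two Kan extensions then compose.
  have h₃ : F.IsLeftKanExtension (𝟙 (L ⋙ F)) :=
    (Functor.isRightDerivedFunctor_iff_isLeftKanExtension F (𝟙 (L ⋙ F))
      ((MorphismProperty.isomorphisms _).inverseImage L)).1
        (Functor.isRightDerivedFunctor_of_inverts _ F (Iso.refl (L ⋙ F)))
  exact (Functor.isLeftKanExtension_iff_postcompose (𝟙 ((yoneda (C := C)) ⋙ L ⋙ F)) (yoneda ⋙ L)
    (Iso.refl _) (𝟙 (L ⋙ F)) _ (by ext; simp)).1 h₃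

end

/-! ### The spectral site of an etale map -/

namespace Geometry

variable {ℬ : Type u} [Category.{w} ℬ] [IsLocallyFinitelyPresentable.{w} ℬ] (𝒢 : Geometry ℬ)
  {B C : ℬ} (n : B ⟶ C) (hn : 𝒢.IsFPEtale B (Under.mk n))

/-- Composition with a finitely presented etale arrow. -/
def precompose : 𝒢.EtaleGenerator C ⥤ 𝒢.EtaleGenerator B :=
  ObjectProperty.lift _ ((𝒢.IsFPEtale C).ι ⋙ Under.map n) fun d =>
    Etale.comp (𝒢 := 𝒢) (m := d.obj.hom) hn d.property

/-- Pushout along an etale map is left adjoint to composition with it. -/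
def pushAdjPrecompose : 𝒢.push n ⊣ 𝒢.precompose n hn :=
  (Under.mapPushoutAdj n).restrictFullyFaithful (𝒢.IsFPEtale B).fullyFaithfulι
    (𝒢.IsFPEtale C).fullyFaithfulι (Iso.refl _) (Iso.refl _)

/-- The map from `n` to the composite of `n` with an etale map. -/
def toPrecompose (d : 𝒢.EtaleGenerator C) :
    (⟨Under.mk n, hn⟩ : 𝒢.EtaleGenerator B) ⟶ (𝒢.precompose n hn).obj d :=
  ObjectProperty.homMk (Under.homMk d.obj.hom rfl)

/-- The spectral site of `C` is the slice over `n` of the spectral site of `B`. -/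
def siteOver : 𝒢.Site C ⥤ Over (op ⟨Under.mk n, hn⟩ : 𝒢.Site B) where
  obj d := Over.mk (Y := op ((𝒢.precompose n hn).obj d.unop)) (𝒢.toPrecompose n hn d.unop).op
  map {d d'} f := Over.homMk ((𝒢.precompose n hn).map f.unop).op (by
    apply Quiver.Hom.unop_inj
    ext
    exact Under.w f.unop.hom)
  map_id d := by ext; rfl
  map_comp f g := by ext; rfl

instance : (𝒢.siteOver n hn).Faithful where
  map_injective {d d'} f g h := by
    apply Quiver.Hom.unop_inj
    ext
    exact congr_arg (fun f => f.left.unop.hom.right) h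

instance : (𝒢.siteOver n hn).Full where
  map_surjective {d d'} f := by
    let r : d'.unop.obj.right ⟶ d.unop.obj.right := f.left.unop.hom.right
    have hr : d'.unop.obj.hom ≫ r = d.unop.obj.hom :=
      congr_arg (fun f => f.unop.hom.right) (Over.w f)
    let r' : d'.unop ⟶ d.unop := ObjectProperty.homMk (Under.homMk r hr)
    refine ⟨r'.op, ?_⟩
    ext
    rfl

/-- This is where cancellation enters: an arrow out of `n` in `𝒱_B` is itself etale under `C`. -/
instance : (𝒢.siteOver n hn).EssSurj where
  mem_essImage Y := by
    let m : C ⟶ Y.left.unop.obj.right := Y.hom.unop.hom.right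
    have hm : n ≫ m = Y.left.unop.obj.hom := Under.w Y.hom.unop.hom
    have hm' : 𝒢.Etale m := Etale.of_comp hn (by rw [hm]; exact Y.left.unop.property)
    let d : 𝒢.EtaleGenerator C := ⟨Under.mk m, hm'⟩
    let i : Y.left.unop ≅ (𝒢.precompose n hn).obj d :=
      (𝒢.IsFPEtale B).isoMk (Under.isoMk (Iso.refl _) ((Category.comp_id _).trans hm.symm))
    refine ⟨op d, ⟨Over.isoMk i.op ?_⟩⟩
    apply Quiver.Hom.unop_inj
    ext
    exact Category.comp_id m

instance : (𝒢.siteOver n hn).IsEquivalence where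

/-- The underlying functor of `siteOver` maps generating families to generating families. -/
theorem map_mem_coverings {d : 𝒢.Site C} {R : Presieve d} (hR : R ∈ 𝒢.coverings C d) :
    R.map (𝒢.siteOver n hn ⋙ Over.forget _) ∈ 𝒢.coverings B _ := by
  obtain ⟨I, n', m, K, K', l, b, b', hl, h, rfl⟩ := hR
  refine ⟨I, fun i => (𝒢.precompose n hn).obj (n' i), fun i => (𝒢.precompose n hn).map (m i),
    K, K', l, b, b', hl, h, ?_⟩
  rw [Presieve.map_ofArrows]
  rfl

theorem coverPreserving_siteOver : CoverPreserving (𝒢.topology C) (𝒢.topology B)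
    (𝒢.siteOver n hn ⋙ Over.forget _) := by
  have h : 𝒢.topology C ≤
      (𝒢.siteOver n hn).restrictedTopology ((𝒢.topology B).over (op ⟨Under.mk n, hn⟩)) := by
    refine Precoverage.toGrothendieck_le_iff_le_toPrecoverage.2 fun d R hR => ?_
    refine Functor.mem_restrictedTopology_of_functorPushforward_mem ?_
    rw [GrothendieckTopology.mem_over_iff]
    have := Precoverage.generate_mem_toGrothendieck (𝒢.map_mem_coverings n hn hR)
    rw [Sieve.generate_map_eq_functorPushforward, Sieve.functorPushforward_comp] at this
    exact this
  have h' := CoverPreserving.of_isContinuous (𝒢.siteOver n hn)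
    ((𝒢.siteOver n hn).restrictedTopology ((𝒢.topology B).over (op ⟨Under.mk n, hn⟩)))
    ((𝒢.topology B).over (op ⟨Under.mk n, hn⟩))
  have h'' := CoverPreserving.comp _ _ h' ((𝒢.topology B).over_forget_coverPreserving _)
  exact ⟨fun hS => h''.cover_preserve (h _ hS)⟩

variable {n hn}

/-- Induction on the generation of `J_B`. An arbitrary `φ` is allowed because the intermediate
sieves live on objects outside the image of the site of `C`. -/
theorem functorPullback_pullback_mem {Y : 𝒢.Site B} {R : Sieve Y} (hR : R ∈ 𝒢.topology B Y)
    (d : 𝒢.Site C) (φ : ((𝒢.siteOver n hn).obj d).left ⟶ Y) :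
    (R.pullback φ).functorPullback (𝒢.siteOver n hn ⋙ Over.forget _) ∈ 𝒢.topology C d := by
  induction hR generalizing d with
  | of Y R hR =>
    obtain ⟨I, n', m, K, K', l, b, b', hl, h, rfl⟩ := hR
    let ψ : Y.unop.obj.right ⟶ d.unop.obj.right := φ.unop.hom.right
    let m' (i : I) : Y.unop.obj.right ⟶ (n' i).obj.right := (m i).hom.right
    -- The `l i` are not assumed to lie in `𝒱`; etaleness comes from cancellation between objects of
    -- `𝒱_B`.
    have hm (i : I) : 𝒢.Etale (m' i) := by
      refine Etale.of_comp Y.unop.property ?_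
      have e : Y.unop.obj.hom ≫ m' i = (n' i).obj.hom := Under.w (m i).hom
      have hm' : 𝒢.Etale (n' i).obj.hom := (n' i).property
      exact e ▸ hm'
    have hP (i : I) : IsPushout (m' i) ψ _ _ := IsPushout.of_hasPushout (m' i) ψ
    let q (i : I) : 𝒢.EtaleGenerator C :=
      ⟨Under.mk (d.unop.obj.hom ≫ pushout.inr (m' i) ψ),
        Etale.comp (𝒢 := 𝒢) d.unop.property ((hm i).of_isPushout (hP i))⟩
    let p (i : I) : d.unop ⟶ q i :=
      ObjectProperty.homMk (Under.homMk (pushout.inr (m' i) ψ) rfl)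
    let r (i : I) : n' i ⟶ (𝒢.precompose n hn).obj (q i) :=
      ObjectProperty.homMk (Under.homMk (pushout.inl (m' i) ψ) (by
        have e : Y.unop.obj.hom ≫ m' i = (n' i).obj.hom := Under.w (m i).hom
        have e' : Y.unop.obj.hom ≫ ψ = n ≫ d.unop.obj.hom := Under.w φ.unop.hom
        have w : (n' i).obj.hom ≫ pushout.inl (m' i) ψ =
            n ≫ d.unop.obj.hom ≫ pushout.inr (m' i) ψ := by
          rw [← e, Category.assoc, pushout.condition, reassoc_of% e']
        exact w))
    have hc : Presieve.ofArrows (fun i => op (q i)) (fun i => (p i).op) ∈ 𝒢.coverings C d :=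
      ⟨I, q, p, K, K', l, b ≫ ψ, fun i => b' i ≫ pushout.inl (m' i) ψ, hl,
        fun i => (h i).paste_vert (hP i), rfl⟩
    refine (𝒢.topology C).superset_covering ?_ (Precoverage.generate_mem_toGrothendieck hc)
    rw [Sieve.generate_le_iff]
    rintro _ _ ⟨i⟩
    refine ⟨_, (r i).op, (m i).op, ⟨i⟩, ?_⟩
    apply Quiver.Hom.unop_inj
    ext
    exact pushout.condition
  | top Y =>
    exact (𝒢.topology C).superset_covering (fun _ _ _ => trivial) ((𝒢.topology C).top_mem d)
  | pullback Y R hR Z f ih =>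
    rw [← Sieve.pullback_comp]
    exact ih d _
  | transitive Y R R' hR hR' ih ih' =>
    refine (𝒢.topology C).transitive (ih d φ) _ fun d' f hf => ?_
    refine (𝒢.topology C).superset_covering ?_ (ih' hf d' (𝟙 _))
    intro d'' g hg
    let k := ((𝒢.siteOver n hn).map g).left
    let k' := ((𝒢.siteOver n hn).map f).left
    have e : (k ≫ 𝟙 _) ≫ k' ≫ φ = (k ≫ k') ≫ φ := by simp
    have h : R' ((k ≫ 𝟙 _) ≫ k' ≫ φ) := hg
    rw [e] at h
    exact h

theorem functorPullback_mem (d : 𝒢.Site C) (R : Sieve ((𝒢.siteOver n hn).obj d).left)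
    (hR : R ∈ 𝒢.topology B _) :
    R.functorPullback (𝒢.siteOver n hn ⋙ Over.forget _) ∈ 𝒢.topology C d := by
  have h := 𝒢.functorPullback_pullback_mem hR d (𝟙 _)
  rwa [Sieve.pullback_id] at h

end Geometry

/-! ### The spectrum of an etale map -/

namespace Geometry

variable {ℬ : Type u} [Category.{w} ℬ] [IsLocallyFinitelyPresentable.{w} ℬ] (𝒢 : Geometry ℬ)
  {B C : ℬ} (n : B ⟶ C) (hn : 𝒢.IsFPEtale B (Under.mk n))

/-- The slice of the presheaf topos over the presheaf represented by `n`. -/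
def overReprEquivalence : Over (𝒢.repr ⟨Under.mk n, hn⟩) ≌ 𝒢.PSh C :=
  (overYonedaRestrict (𝒢.siteOver n hn)).asEquivalence

/-- The slice of the spectrum over the sheaf represented by `n`. -/
def overSheafReprEquivalence : Over (𝒢.sheafRepr ⟨Under.mk n, hn⟩) ≌ 𝒢.Spec C :=
  overSheafEquivalence (𝒢.siteOver n hn) (𝒢.functorPullback_mem)
    (𝒢.coverPreserving_siteOver n hn)

/-- The compatibility of `overReprEquivalence` and `overSheafReprEquivalence` with
sheafification. -/
def postCompOverSheafReprEquivalence :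
    Over.post (𝒢.ι B).inverse ⋙ (𝒢.overSheafReprEquivalence n hn).functor ≅
      (𝒢.overReprEquivalence n hn).functor ⋙ (𝒢.ι C).inverse :=
  postCompOverSheafEquivalence (𝒢.siteOver n hn) (𝒢.functorPullback_mem)
    (𝒢.coverPreserving_siteOver n hn)

/-- The geometric morphism `Spec(C) ⟶ Spec(B)` given by the slice over the sheaf represented by
`n`. -/
def etaleSpec : GeometricMorphism (𝒢.Spec C) (𝒢.Spec B) :=
  (GeometricMorphism.ofEquivalence (𝒢.overSheafReprEquivalence n hn).symm).comp
    (GeometricMorphism.etale (𝒢.sheafRepr ⟨Under.mk n, hn⟩))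

/-- The product of a representable presheaf with the presheaf represented by `n`. -/
def yonedaCompStarCompOverReprEquivalence :
    yoneda ⋙ Over.star (𝒢.repr ⟨Under.mk n, hn⟩) ⋙ (𝒢.overReprEquivalence n hn).functor ≅
      (𝒢.push n).op ⋙ yoneda :=
  yonedaCompStarIso (𝒢.siteOver n hn) (𝒢.pushAdjPrecompose n hn).op

/-- The restriction of the inverse image of `etaleSpec` to the generic object. -/
def genericCompEtaleSpec :
    (𝒢.push n).op ⋙ 𝒢.generic C ≅ 𝒢.generic B ⋙ (𝒢.etaleSpec n hn).inverse :=
  haveI := (𝒢.ι B).preservesFiniteLimits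
  -- Pushout becomes product with `y*_n`, sheafification moves to `B`, and there it commutes with
  -- the product.
  Functor.isoWhiskerRight (𝒢.yonedaCompStarCompOverReprEquivalence n hn).symm (𝒢.ι C).inverse ≪≫
    Functor.isoWhiskerLeft (yoneda ⋙ Over.star (𝒢.repr ⟨Under.mk n, hn⟩))
      (𝒢.postCompOverSheafReprEquivalence n hn).symm ≪≫
    Functor.isoWhiskerLeft yoneda (Functor.isoWhiskerRight
      (GeometricMorphism.starCompPostIso (𝒢.ι B).inverse (𝒢.repr ⟨Under.mk n, hn⟩))
      (𝒢.overSheafReprEquivalence n hn).functor)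

/-- The inverse image has a right adjoint, so it is the Kan extension of its restriction to
`generic`; that restriction is `genericCompEtaleSpec`, and Kan extensions are unique. -/
theorem isSpecMap_etaleSpec : 𝒢.IsSpecMap n (𝒢.etaleSpec n hn) := by
  have : (𝒢.etaleSpec n hn).inverse.IsLeftAdjoint := (𝒢.etaleSpec n hn).adj.isLeftAdjoint
  have : (𝒢.ι B).direct.Full := inferInstanceAs (sheafToPresheaf _ _).Full
  have : (𝒢.ι B).direct.Faithful := inferInstanceAs (sheafToPresheaf _ _).Faithful
  have : (𝒢.etaleSpec n hn).inverse.IsLeftKanExtension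
      (𝟙 (𝒢.generic B ⋙ (𝒢.etaleSpec n hn).inverse)) :=
    isLeftKanExtension_yoneda_comp (𝒢.ι B).adj (𝒢.etaleSpec n hn).inverse
  exact ⟨Functor.leftKanExtensionUniqueOfIso _ (𝟙 (𝒢.generic B ⋙ (𝒢.etaleSpec n hn).inverse))
    (𝒢.genericCompEtaleSpec n hn).symm
    ((𝒢.generic B).leftKanExtension ((𝒢.push n).op ⋙ 𝒢.generic C))
    ((𝒢.generic B).leftKanExtensionUnit ((𝒢.push n).op ⋙ 𝒢.generic C))⟩

end Geometry

end

theorem mainTheorem11 {ℬ : Type u} [Category.{w} ℬ]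
    [IsLocallyFinitelyPresentable.{w} ℬ] (𝒢 : Geometry ℬ) {B C : ℬ} (n : B ⟶ C)
    (hn : 𝒢.IsFPEtale B (Under.mk n)) :
    (∃ specn : GeometricMorphism (𝒢.Spec C) (𝒢.Spec B), 𝒢.IsSpecMap n specn) ∧
    (∀ specn : GeometricMorphism (𝒢.Spec C) (𝒢.Spec B), 𝒢.IsSpecMap n specn →
      specn.IsEtale ∧
      ∃ e : 𝒢.Spec C ≌ Over (𝒢.sheafRepr ⟨Under.mk n, hn⟩),
        Nonempty (specn ≅ (GeometricMorphism.ofEquivalence e).comp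
          (GeometricMorphism.etale (𝒢.sheafRepr ⟨Under.mk n, hn⟩))) ∧
        ∃ β : ((GeometricMorphism.ofEquivalence e).comp
              ((𝒢.ι B).slice (𝒢.repr ⟨Under.mk n, hn⟩))).comp
                (GeometricMorphism.etale (𝒢.repr ⟨Under.mk n, hn⟩)) ≅
            specn.comp (𝒢.ι B),
          GeometricMorphism.IsTwoPullback.{w, v₁, u₁} β) ∧
    IsGrothendieckTopos.{w} (Over (𝒢.sheafRepr ⟨Under.mk n, hn⟩)) ∧
    IsGrothendieckTopos.{w} (Over (𝒢.repr ⟨Under.mk n, hn⟩)) ∧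
    ∃ α : ((𝒢.ι B).slice (𝒢.repr ⟨Under.mk n, hn⟩)).comp
          (GeometricMorphism.etale (𝒢.repr ⟨Under.mk n, hn⟩)) ≅
        (GeometricMorphism.etale (𝒢.sheafRepr ⟨Under.mk n, hn⟩)).comp (𝒢.ι B),
      GeometricMorphism.IsTwoPullback.{w, v₁, u₁} α := by
  have hα : GeometricMorphism.IsTwoPullback.{w, v₁, u₁}
      (GeometricMorphism.sliceEtaleIso (𝒢.ι B) (𝒢.repr ⟨Under.mk n, hn⟩)) :=
    GeometricMorphism.isTwoPullback_sliceEtaleIso _ _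
  refine ⟨⟨_, 𝒢.isSpecMap_etaleSpec n hn⟩, fun specn hspecn => ?_,
    .of_equivalence (𝒢.overSheafReprEquivalence n hn),
    .of_equivalence (𝒢.overReprEquivalence n hn), _, hα⟩
  obtain ⟨i⟩ := hspecn
  obtain ⟨j⟩ := 𝒢.isSpecMap_etaleSpec n hn
  -- An isomorphism of inverse images is already an invertible `2`-cell, so all claims transfer from
  -- `etaleSpec`.
  let θ : specn ≅ 𝒢.etaleSpec n hn := GeometricMorphism.isoMk (i ≪≫ j.symm)
  exact ⟨⟨_, _, ⟨θ⟩⟩, _, ⟨θ⟩, GeometricMorphism.IsTwoPullback.of_equivalence hα _ θ⟩
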